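/- **Setting.** Let $M,n,d\ge 1$, $F_{m,i}:\mathbb R^d\to\mathbb R^d$ ($m\in[M]$, $i\in[n]$), $F_m=\frac1n\sum_{i=1}^nF_{m,i}$, $F=\sum_{m=1}^MF_m$, and let $g:\mathbb R^d\to\mathbb R\cup\{+\infty\}$ be proper, lower semicontinuous and convex. The decentralized variational inequality asks for $z^*$ with $\langle F(z^*),z-z^*\rangle+g(z)-g(z^*)\ge 0$ for all $z\in\mathbb R^d$; worker $m$ stores $F_{m,1},\dots,F_{m,n}$. *Network.* At each time $t=0,1,2,\dots$ there is a directed graph with edge set $\mathcal E(t)$ on the $M$ workers and a gossip matrix $W(t)\in\mathbb R^{M\times M}$, acting on $(\mathbb R^d)^M$. The network is admissible with parameters $B\ge1$ and $\chi\ge 1$ if for every $t$: the graph with edges $\bigcup_{\tau=t}^{t+B-1}\mathcal E(\tau)$ is (strongly) connected; $w_{ij}(t)\ne0$ if and only if $i=j$ or $(i,j)\in\mathcal E(t)$; $\ker W(t)\supset\{z: z_1=\dots=z_M\}$; $\operatorname{range}W(t)\subset\{z:\sum_mz_m=0\}$; and, with $W_B(t)=I-\prod_{\tau=t}^{t+B-1}(I-W(\tau))$,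 $\|W_B(t)z-z\|^2\le(1-\chi^{-1})\|z\|^2$ for all $z\in\operatorname{range}W_B(t)$. *Procedures.* Worker $m$ has a memory $\mathcal M_m$, initially $\{0\}$. Each iteration is either local or a communication round, and this choice and the batch sizes may be random and may depend on everything seen so far. In a local iteration worker $m$ chooses a size $b$, samples a batch $S_m\subset[n]$ uniformly among the subsets of size $b$, independently of the past and of the other workers, at the cost of $b$ local computations, and adds to $\mathcal M_m$ finitely many points of the span of the points $z'$, $\sum_{i\in S_m}F_{m,i}(z'')$ and $\operatorname{prox}_{\rho g}(v)$, where $\rho>0$, $v$ lies in the span of the $z'''$ and the $\sum_{i\in S_m}F_{m,i}(z'')$, and $z',z'',z'''\in\mathcal M_m$. In the communication round number $t$, $\mathcal M_m$ is replaced by the span of $\mathcal M_m\cup\bigcup_{(i,m)\in\mathcal E(t)}\mathcal M_i$. The output $\hat z$ is a point of the span of $\bigcup_m\mathcal M_m$. The procedure uses $K$ communication rounds and $N$ local computations if almost surely it makes at most $K$ communication rounds and every worker makes at most $N$ local computations. It reaches an $\varepsilon$-solution if $\mathbb E\|\hat z-z^*\|^2\le\varepsilon$. **Statement.** There are absolute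 constants $c,\varepsilon_0>0$ such that the following holds for all $\mu>0$, $n,B\in\mathbb N$, $\chi\ge3$ and $\overline L\ge\sqrt n\,\mu$, where $L=\overline L/\sqrt n$. For every $\delta>0$ there are numbers $M,d$, a decentralized variational inequality on $\mathbb R^d$ with $M$ workers, and an admissible time-varying network with parameters $B$ and $\chi$, such that each $F_m$ is $L$-Lipschitz; for each $m$, $\frac1n\sum_{i}\|F_{m,i}(u)-F_{m,i}(v)\|^2\le\overline L^2\|u-v\|^2$ for all $u,v$; $F$ is $\mu$-strongly monotone (and each $F_m$ is $\frac{\mu}{M}$-strongly monotone); the solution $z^*$ is non-zero; and, with $R_0^2=\|0-z^*\|^2$, for every $\varepsilon\in[\delta R_0^2,\varepsilon_0R_0^2]$, every procedure that reaches an $\varepsilon$-solution with $K$ communication rounds and $N$ local computations satisfies $$K\ \ge\ c\,B\chi\Big(1+\frac L\mu\Big)\log\frac{R_0^2}{\varepsilon}\qquad\text{and}\qquad N\ \ge\ c\,\Big(n+\sqrt n\,\frac{\overline L}\mu\Big)\log\frac{R_0^2}{\varepsilon}.$$ -/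

import Mathlib

open MeasureTheory
open scoped ENNReal

/-- The space `ℝ^d` with its Euclidean inner product and norm. -/
abbrev Vec (d : ℕ) : Type := EuclideanSpace ℝ (Fin d)

/-! ### Decentralized variational inequalities -/

/-- The data of a decentralized finite-sum variational inequality on `ℝ^d`: `M` workers, each of
which stores `n` operators `F m i`, and a common regularizer `g` with values in `ℝ ∪ {+∞}`
(the value `-∞` is excluded by `DecentralizedVI.RegularizerOK`). -/
structure DecentralizedVI (M n d : ℕ) where
  /-- the operators `F_{m,i}` -/
  F : Fin M → Fin n → Vec d → Vec d
  /-- the regularizer -/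
  g : Vec d → EReal

namespace DecentralizedVI

variable {M n d : ℕ}

/-- The operator `F_m = (1/n) ∑_i F_{m,i}` of worker `m`. -/
noncomputable def localOp (P : DecentralizedVI M n d) (m : Fin M) (z : Vec d) : Vec d :=
  (n : ℝ)⁻¹ • ∑ i, P.F m i z

/-- The global operator `F = ∑_m F_m`. -/
noncomputable def globalOp (P : DecentralizedVI M n d) (z : Vec d) : Vec d :=
  ∑ m, P.localOp m z

/-- `g` is a proper lower semicontinuous convex function with values in `ℝ ∪ {+∞}`
(convexity is convexity of the epigraph). -/
def RegularizerOK (P : DecentralizedVI M n d) : Prop :=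
  (∀ z, P.g z ≠ ⊥) ∧ (∃ z, P.g z ≠ ⊤) ∧ LowerSemicontinuous P.g ∧
    Convex ℝ {p : Vec d × ℝ | P.g p.1 ≤ (p.2 : EReal)}

/-- `z` solves the variational inequality:
`⟨F(z), w - z⟩ + g(w) - g(z) ≥ 0` for all `w` (where `g(z)` is finite). -/
def IsSolution (P : DecentralizedVI M n d) (z : Vec d) : Prop :=
  P.g z ≠ ⊤ ∧ ∀ w, P.g z ≤ ((inner ℝ (P.globalOp z) (w - z) : ℝ) : EReal) + P.g w

/-- `p = prox_{ρ g}(v)`, i.e. `p` minimizes `y ↦ ρ g(y) + ‖y - v‖² / 2`. -/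
def IsProx (P : DecentralizedVI M n d) (ρ : ℝ) (v p : Vec d) : Prop :=
  ∀ y, (ρ : EReal) * P.g p + ((‖p - v‖ ^ 2 / 2 : ℝ) : EReal) ≤
    (ρ : EReal) * P.g y + ((‖y - v‖ ^ 2 / 2 : ℝ) : EReal)

/-- Each `F_m` is `L`-Lipschitz. -/
def IsLipschitz (P : DecentralizedVI M n d) (L : ℝ) : Prop :=
  ∀ m u v, ‖P.localOp m u - P.localOp m v‖ ≤ L * ‖u - v‖

/-- For each worker `m` the collection `F_{m,1}, …, F_{m,n}` is `Lbar`-average Lipschitz. -/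
def IsAverageLipschitz (P : DecentralizedVI M n d) (Lbar : ℝ) : Prop :=
  ∀ m u v, (n : ℝ)⁻¹ * ∑ i, ‖P.F m i u - P.F m i v‖ ^ 2 ≤ Lbar ^ 2 * ‖u - v‖ ^ 2

/-- The points that worker `m` may add to its memory `Mem` in one local iteration, given the
sampled batch `S`: the span of the points `z'`, `∑_{i ∈ S} F_{m,i}(z'')` and
`prox_{ρ g}(v)`, where `v` is in the span of the `z'''` and the `∑_{i ∈ S} F_{m,i}(z'')`;
here `z'`, `z''`, `z'''` range over `Mem` and `ρ` over the positive reals. -/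
def oracleSpan (P : DecentralizedVI M n d) (m : Fin M) (S : Finset (Fin n))
    (Mem : Set (Vec d)) : Submodule ℝ (Vec d) :=
  Submodule.span ℝ (Mem ∪ (fun z => ∑ i ∈ S, P.F m i z) '' Mem ∪
    {p | ∃ ρ : ℝ, 0 < ρ ∧
      ∃ v ∈ Submodule.span ℝ (Mem ∪ (fun z => ∑ i ∈ S, P.F m i z) '' Mem), P.IsProx ρ v p})

end DecentralizedVI

/-- `μ`-strong monotonicity of an operator. -/
def IsStronglyMonotone {d : ℕ} (μ : ℝ) (A : Vec d → Vec d) : Prop :=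
  ∀ u v, μ * ‖u - v‖ ^ 2 ≤ inner ℝ (A u - A v) (u - v)

/-! ### Time-varying networks -/

/-- `M` workers with a sequence of directed graphs (`Edge t i j` says that `(i, j)` is an edge of
the graph at time `t`) and a sequence of gossip matrices. -/
structure TVNetwork (M : ℕ) where
  /-- the edges at time `t` -/
  Edge : ℕ → Fin M → Fin M → Prop
  /-- the gossip matrix at time `t` -/
  W : ℕ → Matrix (Fin M) (Fin M) ℝ

/-- The action of an `M × M` matrix on `(ℝ^d)^M`, i.e. of the Kronecker product `A ⊗ I_d`. -/
def gossip {M d : ℕ} (A : Matrix (Fin M) (Fin M) ℝ) (z : Fin M → Vec d) : Fin M → Vec d :=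
  fun i => ∑ j, A i j • z j

namespace TVNetwork

variable {M : ℕ}

/-- The product `(I - W(t+T-1)) ⋯ (I - W(t+1)) (I - W(t))`. -/
def mixing (N : TVNetwork M) (t : ℕ) : ℕ → Matrix (Fin M) (Fin M) ℝ
  | 0 => 1
  | T + 1 => (1 - N.W (t + T)) * N.mixing t T

/-- The multi-consensus gossip matrix `W_T(t) = I - ∏_{τ=t}^{t+T-1} (I - W(τ))`. -/
def multiW (N : TVNetwork M) (T t : ℕ) : Matrix (Fin M) (Fin M) ℝ :=
  1 - N.mixing t T

/-- The network is `B`-connected and its gossip matrices, acting on `(ℝ^d)^M`, have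
characteristic number `χ`. -/
structure IsAdmissible (N : TVNetwork M) (d B : ℕ) (χ : ℝ) : Prop where
  /-- the union of the graphs over any `B` consecutive times is (strongly) connected -/
  connected : ∀ t i j,
    Relation.ReflTransGen (fun a b => ∃ τ, t ≤ τ ∧ τ < t + B ∧ N.Edge τ a b) i j
  /-- `W(t)` is supported exactly on the nodes and edges -/
  support : ∀ t i j, N.W t i j ≠ 0 ↔ i = j ∨ N.Edge t i j
  /-- the kernel of `W(t)` contains the consensus space -/
  ker : ∀ t (z : Fin M → Vec d), (∀ i j, z i = z j) → gossip (N.W t) z = 0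
  /-- the range of `W(t)` consists of vectors with zero sum -/
  range : ∀ t (z : Fin M → Vec d), ∑ i, gossip (N.W t) z i = 0
  /-- a characteristic number is at least one -/
  one_le : 1 ≤ χ
  /-- `‖W_B(t) z - z‖² ≤ (1 - 1/χ) ‖z‖²` on the range of `W_B(t)` -/
  contract : ∀ t (z : Fin M → Vec d), (∃ w : Fin M → Vec d, z = gossip (N.multiW B t) w) →
    ∑ i, ‖gossip (N.multiW B t) z i - z i‖ ^ 2 ≤ (1 - χ⁻¹) * ∑ i, ‖z i‖ ^ 2

end TVNetwork

/-! ### Procedures -/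

/-- A randomized decentralized procedure for the problem `P` over the network `N`, run on a
probability space `(Ω, ℙ)`. Each iteration is either a communication round or a local iteration,
in which worker `m` samples a uniformly random batch of the size `b` that it has chosen
(`b = 0` means that it samples nothing). The type of the iteration and the batch sizes may depend
on all past information (all earlier batches and any internal randomness), and the points that are
added to the memories and the output are arbitrary among those that the oracle permits. -/
structure Procedure {M n d : ℕ} (P : DecentralizedVI M n d) (N : TVNetwork M)
    {Ω : Type*} [mΩ : MeasurableSpace Ω] (ℙ : Measure Ω) where
  /-- the total number of iterations -/
  steps : ℕ
  /-- `info k` is the information that is available before iteration `k` -/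
  info : Filtration ℕ mΩ
  /-- the event that iteration `k` is a communication round -/
  comm : ℕ → Set Ω
  /-- the size of the batch that worker `m` samples in iteration `k` -/
  b : ℕ → Fin M → Ω → ℕ
  /-- the batch that worker `m` samples in iteration `k` -/
  S : ℕ → Fin M → Ω → Finset (Fin n)
  /-- the memory of worker `m` before iteration `k` -/
  mem : ℕ → Fin M → Ω → Set (Vec d)
  /-- the output -/
  out : Ω → Vec d
  comm_meas : ∀ k, MeasurableSet[info k] (comm k)
  b_meas : ∀ k m j, MeasurableSet[info k] {ω | b k m ω = j}
  S_meas : ∀ k m s, MeasurableSet[info (k + 1)] {ω | S k m ω = s}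
  out_meas : Measurable out
  /-- nothing is sampled in a communication round -/
  b_comm : ∀ k m, ∀ ω ∈ comm k, b k m ω = 0
  card_S : ∀ k m ω, (S k m ω).card = b k m ω
  /-- given the past, the batches of the workers are independent, and the batch of worker `m` is
  uniform among the subsets of the chosen size -/
  uniform : ∀ k (A : Set Ω), MeasurableSet[info k] A → ∀ s : Fin M → Finset (Fin n),
    (∀ ω ∈ A, ∀ m, b k m ω = (s m).card) →
      ℙ (A ∩ {ω | ∀ m, S k m ω = s m}) = ℙ A * ∏ m, ((n.choose (s m).card : ℕ) : ℝ≥0∞)⁻¹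
  /-- the memories are initialized by `{0}` -/
  mem_init : ∀ m ω, mem 0 m ω = {0}
  /-- a local iteration adds finitely many permitted points to each memory -/
  mem_local : ∀ k m, ∀ ω ∉ comm k, ∃ A : Set (Vec d), A.Finite ∧
    A ⊆ P.oracleSpan m (S k m ω) (mem k m ω) ∧ mem (k + 1) m ω = mem k m ω ∪ A
  /-- in the communication round with number `t` (counted from zero) worker `m` receives the
  memories of its neighbours at time `t` (and keeps its own) -/
  mem_comm : ∀ k m, ∀ ω ∈ comm k, mem (k + 1) m ω =
    (Submodule.span ℝ (mem k m ω ∪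
      ⋃ i ∈ {i | N.Edge ({j | j < k ∧ ω ∈ comm j}.ncard) i m}, mem k i ω) : Set (Vec d))
  /-- the output is in the span of all memories -/
  out_mem : ∀ ω, out ω ∈ Submodule.span ℝ (⋃ m, mem steps m ω)

namespace Procedure

variable {M n d : ℕ} {P : DecentralizedVI M n d} {N : TVNetwork M}
  {Ω : Type*} [mΩ : MeasurableSpace Ω] {ℙ : Measure Ω}

/-- The number of communication rounds. -/
noncomputable def commRounds (A : Procedure P N ℙ) (ω : Ω) : ℕ :=
  {k | k < A.steps ∧ ω ∈ A.comm k}.ncard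

/-- The number of local computations of worker `m`: a batch of size `b` costs `b`. -/
def localComputations (A : Procedure P N ℙ) (m : Fin M) (ω : Ω) : ℕ :=
  ∑ k ∈ Finset.range A.steps, A.b k m ω

/-- The expected squared distance of the output to `z`, as a number in `[0, ∞]`. -/
noncomputable def expectedSqError (A : Procedure P N ℙ) (z : Vec d) : ℝ≥0∞ :=
  ∫⁻ ω, ENNReal.ofReal (‖A.out ω - z‖ ^ 2) ∂ℙ

end Procedure

/-! ### The hard operators -/

/-! The global operator is `μ z + a (S z - e₀)` with `S` the skew tridiagonal operator, plus a
damping `a r` of the last coordinate. Its zero is exactly `(r, r², …, r^d)`, where `a r² + μ r = a`,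
so that `-log r ≤ μ / a`. A point whose coordinates vanish from index `l` on (level `l`) has
relative squared error at least `r^(2l) - r^(2d)`; accuracy `ε` therefore forces a level of order
`(a / μ) log (R₀² / ε)`. As the regularizer is `0`, prox steps are free of charge and of use, and a
level can only grow through a link `(j, j + 1)` of `S`. It remains to make links expensive in both
currencies.

Communication: the even links belong to worker `0` and the odd ones to worker `2`, so each of them
is stuck after one new coordinate until it hears from the other. The two sit in pairs `0` and `1` of
the network. At every `B`-th round the pairs form a star whose center runs cyclically through the
remaining `k + 1` pairs. A pair that learns something as center passes it on only when it is center
again, so about `B (k + 1)` rounds, with `k + 3 = ⌊χ⌋`, buy one level (`pairLevel_succ_ge`). Yet the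
star averages well enough for characteristic number `χ` (`sum_norm_sq_starMatrix_smul_le`).

Local computation: only component `0` of the `n` components contains links, weighted by `n`. This
costs a factor `√n` in the average Lipschitz constant, and a batch of size `b` meets it with
probability `b / n`. The expected level is thus at most `1 + 2 N / n` (`integral_sum_hits_le`), and
convexity of the exponential converts a bound on the mean level into a bound on the mean error
(`exp_level_le_of_expectedSqError_le`). -/

/-- The vectors whose coordinates with index at least `k` vanish. -/
def leadingSubspace (d k : ℕ) : Submodule ℝ (Vec d) where
  carrier := {z | ∀ j : Fin d, k ≤ j → z j = 0}
  add_mem' hx hy j hj := by simp [hx j hj, hy j hj]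
  zero_mem' := by simp
  smul_mem' c x hx j hj := by simp [hx j hj]

theorem leadingSubspace_mono {d k l : ℕ} (h : k ≤ l) :
    leadingSubspace d k ≤ leadingSubspace d l :=
  fun _ hz j hj => hz j (h.trans hj)

/-- The partner of an index in the matching of `j` with `j + 1` for all `j ≡ p` modulo `2`
(unmatched indices are their own partners). -/
def matchIndex {d : ℕ} (p : ℕ) (k : Fin d) : Fin d :=
  if (k : ℕ) % 2 = p % 2 then (if h : (k : ℕ) + 1 < d then ⟨k + 1, h⟩ else k)
  else ⟨k - 1, by omega⟩

theorem matchIndex_involutive {d : ℕ} (p : ℕ) :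
    Function.Involutive (matchIndex p : Fin d → Fin d) := by
  intro k
  ext
  unfold matchIndex
  split_ifs <;> simp_all <;> omega

/-- The sign of a matched index: `1` at the lower and `-1` at the upper end of a link. -/
def linkSign {d : ℕ} (p : ℕ) (k : Fin d) : ℝ :=
  if k < matchIndex p k then 1 else if matchIndex p k < k then -1 else 0

theorem linkSign_matchIndex {d : ℕ} (p : ℕ) (k : Fin d) :
    linkSign p (matchIndex p k) = -linkSign p k := by
  unfold linkSign
  rw [matchIndex_involutive p k]
  rcases lt_trichotomy k (matchIndex p k) with h | h | h
  · simp [h, h.not_gt]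
  · rw [← h]; simp
  · simp [h, h.not_gt]

theorem linkSign_sq_le {d : ℕ} (p : ℕ) (k : Fin d) : linkSign p k ^ 2 ≤ 1 := by
  unfold linkSign
  split_ifs <;> norm_num

/-- The skew-symmetric operator with the links `(j, j + 1)`, `j ≡ p` modulo `2`. -/
def skewLink {d : ℕ} (p : ℕ) : Vec d →ₗ[ℝ] Vec d where
  toFun z := WithLp.toLp 2 fun k => linkSign p k * z (matchIndex p k)
  map_add' x y := by ext k; simp [mul_add]
  map_smul' c x := by ext k; simp; ring

theorem skewLink_apply {d : ℕ} (p : ℕ) (z : Vec d) (k : Fin d) :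
    skewLink p z k = linkSign p k * z (matchIndex p k) := rfl

/-- Reindexing by the matching swaps the ends of every link and flips the sign, so the sum equals
its negative. -/
theorem inner_skewLink_self {d : ℕ} (p : ℕ) (z : Vec d) : inner ℝ (skewLink p z) z = 0 := by
  have h : inner ℝ (skewLink p z) z = ∑ k, z k * (linkSign p k * z (matchIndex p k)) := by
    simp [PiLp.inner_apply, skewLink_apply]
  have h2 : ∑ k, z k * (linkSign p k * z (matchIndex p k)) =
      ∑ k, -(z k * (linkSign p k * z (matchIndex p k))) := by
    rw [← Equiv.sum_comp (matchIndex_involutive p).toPerm]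
    refine Finset.sum_congr rfl fun k _ => ?_
    simp only [Function.Involutive.coe_toPerm, linkSign_matchIndex, matchIndex_involutive p k]
    ring
  rw [Finset.sum_neg_distrib] at h2
  linarith

theorem norm_skewLink_le {d : ℕ} (p : ℕ) (z : Vec d) : ‖skewLink p z‖ ≤ ‖z‖ := by
  rw [← sq_le_sq₀ (norm_nonneg _) (norm_nonneg _), EuclideanSpace.real_norm_sq_eq,
    EuclideanSpace.real_norm_sq_eq, ← Equiv.sum_comp (matchIndex_involutive p).toPerm]
  rw [← Equiv.sum_comp (matchIndex_involutive p).toPerm fun k => (z k) ^ 2]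
  rw [← Equiv.sum_comp (matchIndex_involutive p).toPerm]
  refine Finset.sum_le_sum fun k _ => ?_
  simp only [Function.Involutive.coe_toPerm, matchIndex_involutive p k, skewLink_apply, mul_pow]
  nlinarith [linkSign_sq_le p k, sq_nonneg (z (matchIndex p k))]

theorem skewLink_mem_succ {d : ℕ} (p : ℕ) {k : ℕ} {z : Vec d} (hz : z ∈ leadingSubspace d k) :
    skewLink p z ∈ leadingSubspace d (k + 1) := by
  intro j hj
  have : z (matchIndex p j) = 0 := by
    apply hz
    unfold matchIndex
    split_ifs <;> first | omega | (simp; omega)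
  simp [skewLink_apply, this]

/-- The only link that could leave the first `k` coordinates is `(k - 1, k)`, and it has the other
parity. -/
theorem skewLink_mem {d : ℕ} {p k : ℕ} (hk : k % 2 = p % 2) {z : Vec d}
    (hz : z ∈ leadingSubspace d k) : skewLink p z ∈ leadingSubspace d k := by
  intro j hj
  rw [skewLink_apply]
  by_cases h0 : (j : ℕ) = 0
  · have : z (matchIndex p j) = 0 := by
      apply hz
      omega
    simp [this]
  · have : z (matchIndex p j) = 0 := by
      apply hz
      unfold matchIndex
      split_ifs <;> first | omega | (simp; omega)
    simp [this]

/-- The restriction to the last coordinate. -/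
def lastCoord {d : ℕ} : Vec d →ₗ[ℝ] Vec d where
  toFun z := WithLp.toLp 2 fun k => if (k : ℕ) + 1 = d then z k else 0
  map_add' x y := by ext k; simp; split_ifs <;> simp
  map_smul' c x := by ext k; simp

theorem lastCoord_apply {d : ℕ} (z : Vec d) (k : Fin d) :
    lastCoord z k = if (k : ℕ) + 1 = d then z k else 0 := rfl

theorem inner_lastCoord_self_nonneg {d : ℕ} (z : Vec d) : 0 ≤ inner ℝ (lastCoord z) z := by
  rw [PiLp.inner_apply]
  refine Finset.sum_nonneg fun k _ => ?_
  rw [lastCoord_apply]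
  split_ifs <;> simp [sq_nonneg]

theorem norm_lastCoord_le {d : ℕ} (z : Vec d) : ‖lastCoord z‖ ≤ ‖z‖ := by
  rw [← sq_le_sq₀ (norm_nonneg _) (norm_nonneg _), EuclideanSpace.real_norm_sq_eq,
    EuclideanSpace.real_norm_sq_eq]
  refine Finset.sum_le_sum fun k _ => ?_
  rw [lastCoord_apply]
  split_ifs <;> simp [sq_nonneg]

theorem lastCoord_mem {d k : ℕ} {z : Vec d} (hz : z ∈ leadingSubspace d k) :
    lastCoord z ∈ leadingSubspace d k := by
  intro j hj
  simp [lastCoord_apply, hz j hj]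

/-- The first unit vector. -/
def firstVec (d : ℕ) : Vec d := WithLp.toLp 2 fun k => if (k : ℕ) = 0 then 1 else 0

theorem firstVec_apply {d : ℕ} (k : Fin d) : firstVec d k = if (k : ℕ) = 0 then 1 else 0 := rfl

theorem firstVec_mem {d k : ℕ} (hk : 1 ≤ k) : firstVec d ∈ leadingSubspace d k := by
  intro j hj
  rw [firstVec_apply, if_neg (by omega)]

/-- The skew part of worker `w`: worker `0` has the even links, worker `2` the odd ones. -/
def workerSkew {d : ℕ} (w : ℕ) : Vec d →ₗ[ℝ] Vec d :=
  (if w = 0 then skewLink 0 else 0) + (if w = 2 then skewLink 1 else 0)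

/-- The damping part of worker `w`, present at worker `4` only. -/
def workerDamping {d : ℕ} (w : ℕ) : Vec d →ₗ[ℝ] Vec d := if w = 4 then lastCoord else 0

theorem workerSkew_eq {d : ℕ} (w : ℕ) :
    (workerSkew w : Vec d →ₗ[ℝ] Vec d) = 0 ∨ ∃ p, (workerSkew w : Vec d →ₗ[ℝ] Vec d) = skewLink p := by
  unfold workerSkew
  by_cases h0 : w = 0
  · right; exact ⟨0, by simp [h0]⟩
  · by_cases h2 : w = 2
    · right; exact ⟨1, by simp [h2]⟩
    · left; simp [h0, h2]

theorem norm_workerSkew_le {d : ℕ} (w : ℕ) (z : Vec d) : ‖workerSkew w z‖ ≤ ‖z‖ := by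
  rcases workerSkew_eq (d := d) w with h | ⟨p, h⟩
  · simp [h]
  · rw [h]; exact norm_skewLink_le p z

theorem inner_workerSkew_self {d : ℕ} (w : ℕ) (z : Vec d) : inner ℝ (workerSkew w z) z = 0 := by
  rcases workerSkew_eq (d := d) w with h | ⟨p, h⟩
  · simp [h]
  · rw [h]; exact inner_skewLink_self p z

theorem workerSkew_mem_succ {d : ℕ} (w : ℕ) {k : ℕ} {z : Vec d} (hz : z ∈ leadingSubspace d k) :
    workerSkew w z ∈ leadingSubspace d (k + 1) := by
  rcases workerSkew_eq (d := d) w with h | ⟨p, h⟩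
  · simp [h]
  · rw [h]; exact skewLink_mem_succ p hz

theorem workerSkew_mem {d w k : ℕ} (h0 : w = 0 → k % 2 = 0) (h2 : w = 2 → k % 2 = 1)
    {z : Vec d} (hz : z ∈ leadingSubspace d k) : workerSkew w z ∈ leadingSubspace d k := by
  unfold workerSkew
  refine Submodule.add_mem _ ?_ ?_
  · split_ifs with h
    · exact skewLink_mem (by simpa using h0 h) hz
    · simp
  · split_ifs with h
    · exact skewLink_mem (by simpa using h2 h) hz
    · simp

theorem norm_workerDamping_le {d : ℕ} (w : ℕ) (z : Vec d) : ‖workerDamping w z‖ ≤ ‖z‖ := by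
  unfold workerDamping
  split_ifs
  · exact norm_lastCoord_le z
  · simp

theorem inner_workerDamping_self_nonneg {d : ℕ} (w : ℕ) (z : Vec d) :
    0 ≤ inner ℝ (workerDamping w z) z := by
  unfold workerDamping
  split_ifs
  · exact inner_lastCoord_self_nonneg z
  · simp

theorem workerDamping_mem {d w k : ℕ} {z : Vec d} (hz : z ∈ leadingSubspace d k) :
    workerDamping w z ∈ leadingSubspace d k := by
  unfold workerDamping
  split_ifs
  · exact lastCoord_mem hz
  · simp

/-- The hard problem: globally `F(z) = μ z + a (S z - e₀) + a r z_{d-1} e_{d-1}` with `S` the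
skew-symmetric tridiagonal operator, whose links sit in the component `0` of two workers. -/
noncomputable def hardVI (M n d : ℕ) (μ a r : ℝ) : DecentralizedVI M n d where
  F w i z := (μ / M) • z + (a * r) • workerDamping w z +
    ((if (i : ℕ) = 0 then (n : ℝ) else 0) * a) • workerSkew w z - (a / M) • firstVec d
  g _ := 0

/-! ### Regularity constants and solution of the hard problem -/

section hardVI

variable {M n d : ℕ} {μ a r : ℝ}

theorem hardVI_regularizerOK : (hardVI M n d μ a r).RegularizerOK := by
  refine ⟨fun z => by simp [hardVI], ⟨0, by simp [hardVI]⟩, ?_, ?_⟩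
  · exact lowerSemicontinuous_const
  · have : {p : Vec d × ℝ | (hardVI M n d μ a r).g p.1 ≤ (p.2 : EReal)} =
        Set.univ ×ˢ Set.Ici (0 : ℝ) := by
      ext p
      simp [hardVI, EReal.coe_nonneg]
    rw [this]
    exact convex_univ.prod (convex_Ici 0)

theorem isProx_hardVI {ρ : ℝ} {v p : Vec d} (h : (hardVI M n d μ a r).IsProx ρ v p) : p = v := by
  have h1 := h v
  simp only [hardVI, mul_zero, zero_add, sub_self, norm_zero, EReal.coe_le_coe_iff] at h1
  have h2 : ‖p - v‖ ^ 2 ≤ 0 := by linarith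
  have h3 : ‖p - v‖ = 0 := by nlinarith [norm_nonneg (p - v)]
  exact sub_eq_zero.1 (norm_eq_zero.1 h3)

theorem hardVI_localOp (hn : 1 ≤ n) (w : Fin M) (z : Vec d) :
    (hardVI M n d μ a r).localOp w z = (μ / M) • z + (a * r) • workerDamping w z +
      a • workerSkew w z - (a / M) • firstVec d := by
  have hn0 : (n : ℝ) ≠ 0 := by positivity
  have hs : ∑ i : Fin n, (if (i : ℕ) = 0 then (n : ℝ) else 0) = n := by
    rw [Fin.sum_univ_eq_sum_range (fun i => if i = 0 then (n : ℝ) else 0)]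
    simp
    omega
  simp only [DecentralizedVI.localOp, hardVI, Finset.sum_sub_distrib, Finset.sum_add_distrib,
    ← Finset.sum_smul, ← Finset.sum_mul, hs]
  simp only [Finset.sum_const, Finset.card_univ, Fintype.card_fin, ← Nat.cast_smul_eq_nsmul ℝ,
    smul_add, smul_sub, smul_smul, smul_eq_mul, ← mul_assoc, inv_mul_cancel₀ hn0, one_mul]

theorem hardVI_F_sub (w : Fin M) (i : Fin n) (u v : Vec d) :
    (hardVI M n d μ a r).F w i u - (hardVI M n d μ a r).F w i v =
      (μ / M) • (u - v) + (a * r) • workerDamping w (u - v) +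
        ((if (i : ℕ) = 0 then (n : ℝ) else 0) * a) • workerSkew w (u - v) := by
  simp only [hardVI, map_sub, smul_sub]
  abel

theorem hardVI_localOp_sub (hn : 1 ≤ n) (w : Fin M) (u v : Vec d) :
    (hardVI M n d μ a r).localOp w u - (hardVI M n d μ a r).localOp w v =
      (μ / M) • (u - v) + (a * r) • workerDamping w (u - v) + a • workerSkew w (u - v) := by
  simp only [hardVI_localOp hn, map_sub, smul_sub]
  abel

theorem hardVI_isLipschitz {L : ℝ} (hn : 1 ≤ n) (hM : 6 ≤ M) (hμ : 0 < μ) (hL : μ ≤ L)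
    (ha : a = L / 4) (hr0 : 0 ≤ r) (hr1 : r ≤ 1) : (hardVI M n d μ a r).IsLipschitz L := by
  intro w u v
  rw [hardVI_localOp_sub hn]
  have hM' : (6 : ℝ) ≤ M := by exact_mod_cast hM
  have ha0 : 0 ≤ a := by linarith
  have h1 : μ / M ≤ L / 6 := by
    rw [div_le_div_iff₀ (by positivity) (by norm_num)]
    nlinarith
  have h0 : 0 ≤ μ / M := by positivity
  have h2 : a * r ≤ L / 4 := by nlinarith
  have h3 : 0 ≤ a * r := by positivity
  refine (norm_add₃_le).trans ?_
  rw [norm_smul, norm_smul, norm_smul, Real.norm_of_nonneg h0, Real.norm_of_nonneg h3,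
    Real.norm_of_nonneg ha0]
  have k1 := norm_workerDamping_le w (u - v)
  have k2 := norm_workerSkew_le w (u - v)
  have k3 := norm_nonneg (u - v)
  have e1 : μ / M * ‖u - v‖ ≤ L / 6 * ‖u - v‖ := by gcongr
  have e2 : a * r * ‖workerDamping w (u - v)‖ ≤ L / 4 * ‖u - v‖ := by gcongr; linarith
  have e3 : a * ‖workerSkew w (u - v)‖ ≤ L / 4 * ‖u - v‖ := by rw [ha]; gcongr; linarith
  nlinarith

/-- The single component weighted by `n` contributes `n² / n = n` to the mean square, which is the
ratio of `Lbar²` to `L²`. -/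
theorem hardVI_isAverageLipschitz {L Lbar : ℝ} (hn : 1 ≤ n) (hM : 6 ≤ M) (hμ : 0 < μ) (hL : μ ≤ L)
    (ha : a = L / 4) (hr0 : 0 ≤ r) (hr1 : r ≤ 1) (hLbar : Lbar ^ 2 = n * L ^ 2) :
    (hardVI M n d μ a r).IsAverageLipschitz Lbar := by
  intro w u v
  have hM' : (6 : ℝ) ≤ M := by exact_mod_cast hM
  have hn' : (1 : ℝ) ≤ n := by exact_mod_cast hn
  have ha0 : 0 ≤ a := by linarith
  have h1 : μ / M ≤ L / 6 := by
    rw [div_le_div_iff₀ (by positivity) (by norm_num)]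
    nlinarith
  have h0 : 0 ≤ μ / M := by positivity
  have h2 : a * r ≤ L / 4 := by nlinarith
  have h3 : 0 ≤ a * r := by positivity
  set x := ‖u - v‖ with hx
  have hx0 : 0 ≤ x := norm_nonneg _
  have key : ∀ i : Fin n, ‖(hardVI M n d μ a r).F w i u - (hardVI M n d μ a r).F w i v‖ ^ 2 ≤
      (3 * (L / 6) ^ 2 + 3 * (L / 4) ^ 2) * x ^ 2 +
        (if (i : ℕ) = 0 then (n : ℝ) ^ 2 else 0) * (3 * (L / 4) ^ 2 * x ^ 2) := by
    intro i
    rw [hardVI_F_sub]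
    have e1 : ‖(μ / M) • (u - v)‖ ≤ L / 6 * x := by
      rw [norm_smul, Real.norm_of_nonneg h0]
      gcongr
    have e2 : ‖(a * r) • workerDamping w (u - v)‖ ≤ L / 4 * x := by
      rw [norm_smul, Real.norm_of_nonneg h3]
      have := norm_workerDamping_le w (u - v)
      gcongr; linarith
    have e3 : ‖((if (i : ℕ) = 0 then (n : ℝ) else 0) * a) • workerSkew w (u - v)‖ ≤
        (if (i : ℕ) = 0 then (n : ℝ) else 0) * (L / 4 * x) := by
      have := norm_workerSkew_le w (u - v)
      rw [norm_smul, norm_mul, Real.norm_of_nonneg ha0, mul_assoc, ha]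
      split_ifs
      · simp only [Real.norm_natCast]; gcongr; linarith
      · simp
    have e4 := (norm_add₃_le (a := (μ / M) • (u - v)) (b := (a * r) • workerDamping w (u - v))
      (c := ((if (i : ℕ) = 0 then (n : ℝ) else 0) * a) • workerSkew w (u - v))).trans
      (add_le_add (add_le_add e1 e2) e3)
    refine (pow_le_pow_left₀ (norm_nonneg _) e4 2).trans ?_
    have e5 : (if (i : ℕ) = 0 then (n : ℝ) ^ 2 else 0) = (if (i : ℕ) = 0 then (n : ℝ) else 0) ^ 2 := by
      split_ifs <;> simp
    rw [e5]
    generalize (if (i : ℕ) = 0 then (n : ℝ) else 0) = t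
    -- This is `(x + y + z)² ≤ 3 (x² + y² + z²)`.
    nlinarith [sq_nonneg (L / 6 * x - L / 4 * x), sq_nonneg (L / 6 * x - t * (L / 4 * x)),
      sq_nonneg (L / 4 * x - t * (L / 4 * x))]
  have hs : ∑ i : Fin n, (if (i : ℕ) = 0 then (n : ℝ) ^ 2 else 0) = n ^ 2 := by
    rw [Fin.sum_univ_eq_sum_range (fun i => if i = 0 then (n : ℝ) ^ 2 else 0)]
    simp
    omega
  have h4 := Finset.sum_le_sum fun i (_ : i ∈ Finset.univ) => key i
  rw [Finset.sum_add_distrib, Finset.sum_const, ← Finset.sum_mul, hs, Finset.card_univ,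
    Fintype.card_fin, nsmul_eq_mul] at h4
  rw [hLbar, inv_mul_le_iff₀ (by positivity)]
  refine h4.trans ?_
  have h5 : 0 ≤ L ^ 2 * x ^ 2 := by positivity
  have h6 : (n : ℝ) * (L ^ 2 * x ^ 2) ≤ n ^ 2 * (L ^ 2 * x ^ 2) := by
    gcongr; nlinarith
  nlinarith

theorem hardVI_localOp_isStronglyMonotone (hn : 1 ≤ n) (ha : 0 ≤ a) (hr : 0 ≤ r) (w : Fin M) :
    IsStronglyMonotone (μ / M) ((hardVI M n d μ a r).localOp w) := by
  intro u v
  rw [hardVI_localOp_sub hn, inner_add_left, inner_add_left, real_inner_smul_left,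
    real_inner_smul_left, real_inner_smul_left, inner_workerSkew_self, real_inner_self_eq_norm_sq]
  have := mul_nonneg (mul_nonneg ha hr) (inner_workerDamping_self_nonneg w (u - v))
  linarith

theorem hardVI_globalOp_isStronglyMonotone (hn : 1 ≤ n) (hM : 1 ≤ M) (ha : 0 ≤ a) (hr : 0 ≤ r) :
    IsStronglyMonotone μ (hardVI M n d μ a r).globalOp := by
  intro u v
  have hM' : (M : ℝ) ≠ 0 := by positivity
  rw [DecentralizedVI.globalOp, DecentralizedVI.globalOp, ← Finset.sum_sub_distrib, sum_inner]
  have h := Finset.sum_le_sum fun w (_ : w ∈ (Finset.univ : Finset (Fin M))) =>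
    hardVI_localOp_isStronglyMonotone (d := d) (μ := μ) hn ha hr w u v
  refine le_trans (le_of_eq ?_) h
  simp
  field_simp

theorem hardVI_globalOp (hn : 1 ≤ n) (hM : 6 ≤ M) (z : Vec d) :
    (hardVI M n d μ a r).globalOp z = μ • z + (a * r) • lastCoord z +
      a • (skewLink 0 z + skewLink 1 z) - a • firstVec d := by
  have hM' : (M : ℝ) ≠ 0 := by positivity
  have h1 : ∑ w : Fin M, workerDamping w z = lastCoord z := by
    rw [Fin.sum_univ_eq_sum_range (fun w => workerDamping w z),
      Finset.sum_eq_single 4 (fun w _ hw => by simp [workerDamping, hw])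
        (fun h => by simp at h; omega)]
    simp [workerDamping]
  have h2 : ∑ w : Fin M, workerSkew w z = skewLink 0 z + skewLink 1 z := by
    rw [Fin.sum_univ_eq_sum_range (fun w => workerSkew w z)]
    simp only [workerSkew, LinearMap.add_apply, Finset.sum_add_distrib]
    rw [Finset.sum_eq_single 0 (fun w _ hw => by simp [hw]) (fun h => by simp at h; omega),
      Finset.sum_eq_single 2 (fun w _ hw => by simp [hw]) (fun h => by simp at h; omega)]
    simp
  simp only [DecentralizedVI.globalOp, hardVI_localOp hn, Finset.sum_sub_distrib,
    Finset.sum_add_distrib, ← Finset.smul_sum, h1, h2]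
  simp only [Finset.sum_const, Finset.card_univ, Fintype.card_fin, ← Nat.cast_smul_eq_nsmul ℝ,
    smul_smul, div_mul_cancel₀ _ hM']

/-- The geometric vector `(r, r², …, r^d)`. -/
def geomVec (d : ℕ) (r : ℝ) : Vec d := WithLp.toLp 2 fun k => r ^ ((k : ℕ) + 1)

theorem geomVec_apply (k : Fin d) : geomVec d r k = r ^ ((k : ℕ) + 1) := rfl

/-- Each index is the lower end of a link of its own parity and the upper end of one of the other
parity, with exceptions at the two boundary indices. -/
theorem skewLink_add_skewLink_geomVec (k : Fin d) :
    (skewLink 0 (geomVec d r) + skewLink 1 (geomVec d r)) k =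
      (if (k : ℕ) + 1 < d then r ^ ((k : ℕ) + 2) else 0) - if (k : ℕ) = 0 then 0 else r ^ (k : ℕ) := by
  rw [PiLp.add_apply, skewLink_apply, skewLink_apply, geomVec_apply, geomVec_apply]
  have up : ∀ p, (k : ℕ) % 2 = p % 2 → linkSign p k * r ^ ((matchIndex p k : ℕ) + 1) =
      if (k : ℕ) + 1 < d then r ^ ((k : ℕ) + 2) else 0 := by
    intro p hp
    unfold linkSign matchIndex
    simp only [hp, if_true]
    split_ifs <;> simp_all [Fin.lt_def]
  have down : ∀ p, (k : ℕ) % 2 ≠ p % 2 → linkSign p k * r ^ ((matchIndex p k : ℕ) + 1) =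
      -if (k : ℕ) = 0 then 0 else r ^ (k : ℕ) := by
    intro p hp
    unfold linkSign matchIndex
    simp only [hp, if_false, Fin.lt_def]
    by_cases h0 : (k : ℕ) = 0
    · simp [h0]
    · rw [if_neg (by omega), if_pos (by omega), if_neg h0, Nat.sub_add_cancel (by omega)]
      ring
  rcases Nat.mod_two_eq_zero_or_one (k : ℕ) with h | h
  · rw [up 0 (by omega), down 1 (by omega)]; ring
  · rw [up 1 (by omega), down 0 (by omega)]; ring

/-- In the interior, `F = 0` is the recurrence `μ r + a r² = a` times a power of `r`. At the last
index the damping `a r` supplies the missing term `a r^(d+1)`, so truncation is exact; at index `0`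
the vector `e₀` plays the role of `r⁰`. -/
theorem hardVI_isSolution (hn : 1 ≤ n) (hM : 6 ≤ M) (har : a * r ^ 2 + μ * r = a) :
    (hardVI M n d μ a r).IsSolution (geomVec d r) := by
  have h0 : (hardVI M n d μ a r).globalOp (geomVec d r) = 0 := by
    rw [hardVI_globalOp hn hM]
    ext k
    rw [PiLp.sub_apply, PiLp.add_apply, PiLp.add_apply, PiLp.smul_apply, PiLp.smul_apply,
      PiLp.smul_apply, PiLp.smul_apply, skewLink_add_skewLink_geomVec, lastCoord_apply,
      firstVec_apply, geomVec_apply, PiLp.zero_apply]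
    simp only [smul_eq_mul]
    have e : μ * r ^ ((k : ℕ) + 1) + a * r ^ ((k : ℕ) + 2) - a * r ^ (k : ℕ) = 0 := by
      linear_combination r ^ (k : ℕ) * har
    have hk := k.2
    by_cases h1 : (k : ℕ) = 0
    · rw [h1] at e hk ⊢
      by_cases h2 : 0 + 1 < d
      · rw [if_neg (by omega), if_pos h2]
        simp at e ⊢; linarith
      · rw [if_pos (by omega), if_neg h2]
        simp at e ⊢; linarith
    · by_cases h2 : (k : ℕ) + 1 < d
      · rw [if_neg (by omega), if_pos h2, if_neg h1, if_neg h1]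
        linear_combination e
      · rw [if_pos (by omega), if_neg h2, if_neg h1, if_neg h1]
        linear_combination e
  refine ⟨by simp [hardVI], fun w => ?_⟩
  rw [h0]
  simp [hardVI]

end hardVI

/-! ### Distance of the solution from the leading subspaces -/

theorem norm_sq_geomVec (d : ℕ) (r : ℝ) :
    ‖geomVec d r‖ ^ 2 = ∑ k ∈ Finset.range d, (r ^ 2) ^ (k + 1) := by
  rw [EuclideanSpace.real_norm_sq_eq, ← Fin.sum_univ_eq_sum_range (fun k => (r ^ 2) ^ (k + 1))]
  refine Finset.sum_congr rfl fun k _ => ?_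
  rw [geomVec_apply]; ring

theorem geomVec_ne_zero {d : ℕ} {r : ℝ} (hd : 1 ≤ d) (hr : 0 < r) : geomVec d r ≠ 0 := by
  intro h
  have := congrArg (fun z : Vec d => z ⟨0, hd⟩) h
  simp [geomVec_apply] at this
  exact hr.ne' this

/-- The coordinates from `l` on are missed entirely, and their squares form a geometric sum to be
compared with the full one. -/
theorem norm_sq_sub_geomVec_ge {d l : ℕ} {r : ℝ} (hr0 : 0 < r) (hr1 : r < 1) {z : Vec d}
    (hz : z ∈ leadingSubspace d l) :
    ‖geomVec d r‖ ^ 2 * ((r ^ 2) ^ l - (r ^ 2) ^ d) ≤ ‖z - geomVec d r‖ ^ 2 := by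
  set x := r ^ 2 with hx
  have hx0 : 0 < x := by positivity
  have hx1 : x < 1 := by rw [hx]; nlinarith
  rcases le_total d l with hdl | hdl
  · have : x ^ l ≤ x ^ d := pow_le_pow_of_le_one hx0.le hx1.le hdl
    nlinarith [sq_nonneg ‖geomVec d r‖, sq_nonneg ‖z - geomVec d r‖]
  have h1 : ∑ k ∈ Finset.Ico l d, x ^ (k + 1) ≤ ‖z - geomVec d r‖ ^ 2 := by
    rw [EuclideanSpace.real_norm_sq_eq]
    have : ∑ k ∈ Finset.Ico l d, x ^ (k + 1) =
        ∑ k : Fin d, if l ≤ (k : ℕ) then x ^ ((k : ℕ) + 1) else 0 := by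
      rw [Fin.sum_univ_eq_sum_range (fun k => if l ≤ k then x ^ (k + 1) else 0),
        ← Finset.sum_filter]
      refine Finset.sum_congr ?_ fun _ _ => rfl
      ext k; simp [and_comm]
    rw [this]
    refine Finset.sum_le_sum fun k _ => ?_
    split_ifs with hk
    · rw [PiLp.sub_apply, hz k hk, geomVec_apply, hx]
      apply le_of_eq; ring
    · positivity
  refine le_trans ?_ h1
  rw [norm_sq_geomVec, ← hx]
  have g1 : (∑ k ∈ Finset.range d, x ^ (k + 1)) * (1 - x) = x * (1 - x ^ d) := by
    simp only [pow_succ', ← Finset.mul_sum]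
    rw [mul_assoc, geom_sum_mul_neg]
  have g2 : (∑ k ∈ Finset.Ico l d, x ^ (k + 1)) * (1 - x) = x * (x ^ l - x ^ d) := by
    simp only [pow_succ', ← Finset.mul_sum]
    have := geom_sum_Ico_mul x hdl
    linear_combination (-x) * this
  have hd0 : 0 < x ^ d := by positivity
  have hld : x ^ d ≤ x ^ l := pow_le_pow_of_le_one hx0.le hx1.le hdl
  refine le_of_mul_le_mul_right ?_ (sub_pos.2 hx1)
  rw [g2]
  calc _ = (∑ k ∈ Finset.range d, x ^ (k + 1)) * (1 - x) * (x ^ l - x ^ d) := by ring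
    _ = x * (x ^ l - x ^ d) * (1 - x ^ d) := by rw [g1]; ring
    -- The factor `1 - x ^ d` from the full sum is at most one.
    _ ≤ x * (x ^ l - x ^ d) * 1 := by
        refine mul_le_mul_of_nonneg_left (by linarith) (mul_nonneg hx0.le (by linarith))
    _ = _ := by ring

theorem exists_root {a μ : ℝ} (ha : 0 < a) (hμ : 0 < μ) :
    ∃ r, 0 < r ∧ r < 1 ∧ a * r ^ 2 + μ * r = a ∧ -Real.log r ≤ μ / a := by
  obtain ⟨r, ⟨h0, h1⟩, hr⟩ : ∃ r ∈ Set.Icc (0 : ℝ) 1, a * r ^ 2 + μ * r = a := by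
    have hc : ContinuousOn (fun r : ℝ => a * r ^ 2 + μ * r) (Set.Icc 0 1) := by fun_prop
    exact intermediate_value_Icc zero_le_one hc ⟨by simpa using ha.le, by simpa using hμ.le⟩
  have hr0 : 0 < r := h0.lt_of_ne (by rintro rfl; simp at hr; exact ha.ne hr)
  refine ⟨r, hr0, h1.lt_of_ne (by rintro rfl; simp at hr; exact hμ.ne' hr), hr, ?_⟩
  rw [← Real.log_inv]
  -- The equation gives `r⁻¹ = r + μ / a`, hence `log r⁻¹ ≤ r⁻¹ - 1 ≤ μ / a`.
  refine (Real.log_le_sub_one_of_pos (inv_pos.2 hr0)).trans ?_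
  have : r⁻¹ = r + μ / a := by field_simp; linarith
  linarith

/-! ### The slow network -/

/-- The matrix on pairs of workers that averages over each pair and then applies `S`. -/
noncomputable def pairAverage {m : ℕ} (S : Matrix (Fin m) (Fin m) ℝ) :
    Matrix (Fin (m * 2)) (Fin (m * 2)) ℝ :=
  Matrix.of fun w w' => S w.divNat w'.divNat / 2

theorem sum_pairs {m : ℕ} {α : Type*} [AddCommMonoid α] (h : Fin (m * 2) → α) :
    ∑ w, h w = ∑ v : Fin m, (h (finProdFinEquiv (v, 0)) + h (finProdFinEquiv (v, 1))) := by
  rw [← Equiv.sum_comp finProdFinEquiv, Fintype.sum_prod_type]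
  simp only [Fin.sum_univ_two]

theorem divNat_finProdFinEquiv {m : ℕ} (v : Fin m) (s : Fin 2) :
    (finProdFinEquiv (v, s)).divNat = v := by
  exact congrArg Prod.fst (finProdFinEquiv.symm_apply_apply (v, s))

theorem pairAverage_mul {m : ℕ} (S T : Matrix (Fin m) (Fin m) ℝ) :
    pairAverage S * pairAverage T = pairAverage (S * T) := by
  ext w w'
  simp only [pairAverage, Matrix.mul_apply, Matrix.of_apply, sum_pairs, divNat_finProdFinEquiv,
    Finset.sum_div]
  refine Finset.sum_congr rfl fun v _ => ?_
  ring

/-- One step of averaging on the star with center `c`. -/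
noncomputable def starMatrix {m : ℕ} (c : Fin m) : Matrix (Fin m) (Fin m) ℝ :=
  Matrix.of fun v v' => if v = c ∨ v' = c then (m : ℝ)⁻¹ else if v = v' then 1 - (m : ℝ)⁻¹ else 0

theorem starMatrix_comm {m : ℕ} (c v v' : Fin m) : starMatrix c v v' = starMatrix c v' v := by
  simp only [starMatrix, Matrix.of_apply, or_comm, eq_comm]

theorem sum_starMatrix_smul {m : ℕ} {E : Type*} [AddCommGroup E] [Module ℝ E] (c v : Fin m)
    (y : Fin m → E) : ∑ v', starMatrix c v v' • y v' =
      if v = c then (m : ℝ)⁻¹ • ∑ v', y v' else (m : ℝ)⁻¹ • y c + (1 - (m : ℝ)⁻¹) • y v := by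
  split_ifs with h
  · simp [starMatrix, h, Finset.smul_sum]
  · rw [← Finset.add_sum_erase _ _ (Finset.mem_univ c),
      Finset.sum_eq_single_of_mem v (by simp [h])]
    · simp [starMatrix, h]
    · intro v' hv' hne
      simp only [Finset.mem_erase, Finset.mem_univ, and_true] at hv'
      simp [starMatrix, h, hv', hne.symm]

theorem sum_starMatrix {m : ℕ} (c v : Fin m) : ∑ v', starMatrix c v v' = 1 := by
  have hm : (m : ℝ) ≠ 0 := by
    have := c.pos
    positivity
  have := sum_starMatrix_smul c v fun _ => (1 : ℝ)
  simp only [smul_eq_mul, mul_one] at this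
  rw [this]
  split_ifs
  · simp [hm]
  · ring

/-- The center is replaced by the mean, which is `0`. Every other value becomes a convex combination
with weight `1/m` on the center; convexity of the squared norm and the `m - 1` copies of `‖y c‖² /
m` give the factor `1 - 1/m`. -/
theorem sum_norm_sq_starMatrix_smul_le {m : ℕ} {E : Type*} [NormedAddCommGroup E]
    [InnerProductSpace ℝ E] (c : Fin m) (y : Fin m → E) (hy : ∑ v, y v = 0) :
    ∑ v, ‖∑ v', starMatrix c v v' • y v'‖ ^ 2 ≤ (1 - (m : ℝ)⁻¹) * ∑ v, ‖y v‖ ^ 2 := by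
  have hm : (1 : ℝ) ≤ m := by exact_mod_cast c.pos
  have hm1 : (m : ℝ)⁻¹ ≤ 1 := inv_le_one_of_one_le₀ hm
  have hm0 : 0 ≤ (m : ℝ)⁻¹ := by positivity
  simp only [sum_starMatrix_smul, hy, smul_zero]
  rw [← Finset.add_sum_erase _ _ (Finset.mem_univ c), if_pos rfl, norm_zero]
  have h1 : ∀ v ∈ Finset.univ.erase c,
      ‖(if v = c then (0 : E) else (m : ℝ)⁻¹ • y c + (1 - (m : ℝ)⁻¹) • y v)‖ ^ 2 ≤
        (m : ℝ)⁻¹ * ‖y c‖ ^ 2 + (1 - (m : ℝ)⁻¹) * ‖y v‖ ^ 2 := by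
    intro v hv
    rw [if_neg (Finset.ne_of_mem_erase hv)]
    have e := norm_add_le ((m : ℝ)⁻¹ • y c) ((1 - (m : ℝ)⁻¹) • y v)
    rw [norm_smul, norm_smul, Real.norm_of_nonneg hm0,
      Real.norm_of_nonneg (sub_nonneg.2 hm1)] at e
    refine (pow_le_pow_left₀ (norm_nonneg _) e 2).trans ?_
    nlinarith [mul_nonneg (mul_nonneg hm0 (sub_nonneg.2 hm1)) (sq_nonneg (‖y c‖ - ‖y v‖))]
  have h2 := Finset.sum_le_sum h1
  rw [Finset.sum_add_distrib, ← Finset.mul_sum, Finset.sum_const, Finset.card_erase_of_mem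
    (Finset.mem_univ c), Finset.card_univ, Fintype.card_fin, nsmul_eq_mul, Nat.cast_sub c.pos] at h2
  rw [← Finset.add_sum_erase _ (fun v => ‖y v‖ ^ 2) (Finset.mem_univ c)]
  have h3 : (m : ℝ) * (m : ℝ)⁻¹ = 1 := mul_inv_cancel₀ (by positivity)
  have h4 : (m : ℝ)⁻¹ * (((m : ℝ) - (Nat.succ 0 : ℕ)) * ‖y c‖ ^ 2) =
      (1 - (m : ℝ)⁻¹) * ‖y c‖ ^ 2 := by
    push_cast
    linear_combination (‖y c‖ ^ 2) * h3
  rw [h4, ← Finset.mul_sum] at h2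
  linarith

/-- The center of the star in the active round number `j`. -/
def starCenter (k j : ℕ) : Fin (k + 3) :=
  ⟨2 + j % (k + 1), by have := Nat.mod_lt j (by omega : 0 < k + 1); omega⟩

/-- The mixing of pairs at time `t`: a star at the multiples of `B`, nothing at other times. -/
noncomputable def roundMatrix (k B t : ℕ) : Matrix (Fin (k + 3)) (Fin (k + 3)) ℝ :=
  if B ∣ t then starMatrix (starCenter k (t / B)) else 1

/-- The network of `k + 3` pairs of workers: in each round the members of a pair communicate,
and at the multiples of `B` there is a star of pairs, with a moving center. -/
noncomputable def slowNetwork (k B : ℕ) : TVNetwork ((k + 3) * 2) where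
  Edge t w w' := w.divNat = w'.divNat ∨
    (B ∣ t ∧ (w.divNat = starCenter k (t / B) ∨ w'.divNat = starCenter k (t / B)))
  W t := 1 - pairAverage (roundMatrix k B t)

theorem roundMatrix_comm (k B t : ℕ) (v v' : Fin (k + 3)) :
    roundMatrix k B t v v' = roundMatrix k B t v' v := by
  unfold roundMatrix
  split_ifs
  · exact starMatrix_comm _ _ _
  · simp only [Matrix.one_apply, eq_comm]

theorem sum_roundMatrix (k B t : ℕ) (v : Fin (k + 3)) : ∑ v', roundMatrix k B t v v' = 1 := by
  unfold roundMatrix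
  split_ifs
  · exact sum_starMatrix _ _
  · simp [Matrix.one_apply]

theorem sum_pairAverage_roundMatrix (k B t : ℕ) (w : Fin ((k + 3) * 2)) :
    ∑ w', pairAverage (roundMatrix k B t) w w' = 1 := by
  simp only [pairAverage, Matrix.of_apply, sum_pairs, divNat_finProdFinEquiv, add_halves,
    sum_roundMatrix]

theorem pairAverage_roundMatrix_comm (k B t : ℕ) (w w' : Fin ((k + 3) * 2)) :
    pairAverage (roundMatrix k B t) w w' = pairAverage (roundMatrix k B t) w' w := by
  simp only [pairAverage, Matrix.of_apply, roundMatrix_comm k B t w.divNat]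

/-- The pairs are there for the diagonal: rows of `W t` sum to zero, so `w_ii ≠ 0` requires a
neighbour even in rounds without a star. The factor `1/2` keeps the diagonal of `I - W t` below one.
-/
theorem slowNetwork_support (k B t : ℕ) (w w' : Fin ((k + 3) * 2)) :
    (slowNetwork k B).W t w w' ≠ 0 ↔ w = w' ∨ (slowNetwork k B).Edge t w w' := by
  have hk : (k : ℝ) + 3 ≠ 0 := by positivity
  have h1 : 0 < ((k + 3 : ℕ) : ℝ)⁻¹ := by positivity
  have h2 : ((k + 3 : ℕ) : ℝ)⁻¹ < 1 := by
    apply inv_lt_one_of_one_lt₀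
    exact_mod_cast (by omega : 1 < k + 3)
  have hS : ∀ v v', roundMatrix k B t v v' ≠ 0 ↔
      v = v' ∨ (B ∣ t ∧ (v = starCenter k (t / B) ∨ v' = starCenter k (t / B))) := by
    intro v v'
    unfold roundMatrix
    split_ifs with h
    · simp only [starMatrix, Matrix.of_apply, h, true_and]
      split_ifs with h3 h4
      · simp only [h3, or_true, iff_true]; exact h1.ne'
      · simp only [h4, true_or, iff_true]; linarith
      · simp [h3, h4]
    · simp [Matrix.one_apply, h]
  have hd : ∀ v, roundMatrix k B t v v ≤ 1 := by
    intro v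
    unfold roundMatrix
    split_ifs
    · simp only [starMatrix, Matrix.of_apply]
      split_ifs <;> linarith
    · simp
  by_cases h : w = w'
  · subst h
    have := hd w.divNat
    simp only [slowNetwork, pairAverage, Matrix.sub_apply, Matrix.one_apply_eq, Matrix.of_apply,
      true_or, iff_true]
    linarith
  · simp only [slowNetwork, pairAverage, Matrix.sub_apply, Matrix.one_apply_ne h, Matrix.of_apply,
      h, false_or, ← hS]
    simp

/-- A window of at most `B` rounds contains at most one star, and all other factors are pure pair
averages. The length is `T + 1` because the empty product is `1`, not `pairAverage 1`. -/
theorem slowNetwork_mixing {k B t t₀ : ℕ} (h0 : B ∣ t₀) (h1 : t ≤ t₀) (h2 : t₀ < t + B)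
    (T : ℕ) (hT : T + 1 ≤ B) : (slowNetwork k B).mixing t (T + 1) =
      pairAverage (if t₀ ≤ t + T then starMatrix (starCenter k (t₀ / B)) else 1) := by
  have step : ∀ s, t ≤ s → s < t + B → roundMatrix k B s =
      if s = t₀ then starMatrix (starCenter k (t₀ / B)) else 1 := by
    intro s hs hs'
    unfold roundMatrix
    by_cases h : s = t₀
    · simp [h, h0]
    · rw [if_neg h, if_neg]
      intro hd
      rcases lt_or_gt_of_ne h with h | h
      · have := Nat.le_of_dvd (by omega) (Nat.dvd_sub h0 hd); omega
      · have := Nat.le_of_dvd (by omega) (Nat.dvd_sub hd h0); omega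
  have hW : ∀ s, 1 - (slowNetwork k B).W s = pairAverage (roundMatrix k B s) :=
    fun s => sub_sub_cancel _ _
  induction T with
  | zero =>
    rw [TVNetwork.mixing, TVNetwork.mixing, mul_one, hW, step _ (by omega) (by omega)]
    congr 1
    simp only [add_zero]
    exact if_congr ⟨fun h => h.ge, fun h => le_antisymm h1 h⟩ rfl rfl
  | succ T ih =>
    rw [TVNetwork.mixing, ih (by omega), hW, pairAverage_mul, step _ (by omega) (by omega)]
    congr 1
    by_cases ha : t + (T + 1) = t₀
    · rw [if_pos ha, if_neg (by omega), if_pos (by omega), mul_one]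
    · by_cases hb : t₀ ≤ t + T
      · rw [if_neg ha, if_pos hb, if_pos (by omega), one_mul]
      · rw [if_neg ha, if_neg hb, if_neg (by omega), one_mul]

theorem exists_dvd_window (B t : ℕ) (hB : 1 ≤ B) : ∃ t₀, B ∣ t₀ ∧ t ≤ t₀ ∧ t₀ < t + B := by
  refine ⟨B * ((t + B - 1) / B), dvd_mul_right _ _, ?_, ?_⟩
  · have := Nat.lt_mul_div_succ (t + B - 1) hB
    rw [mul_add] at this
    omega
  · have := Nat.mul_div_le (t + B - 1) B
    omega

theorem slowNetwork_isAdmissible (k d B : ℕ) (hB : 1 ≤ B) {χ : ℝ} (hχ : (k + 3 : ℕ) ≤ χ) :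
    (slowNetwork k B).IsAdmissible d B χ where
  connected t w w' := by
    obtain ⟨t₀, h0, h1, h2⟩ := exists_dvd_window B t hB
    have hc := divNat_finProdFinEquiv (starCenter k (t₀ / B)) 0
    refine Relation.ReflTransGen.trans
      (b := finProdFinEquiv (starCenter k (t₀ / B), 0)) (.single ?_) (.single ?_)
    · exact ⟨t₀, h1, h2, .inr ⟨h0, .inr hc⟩⟩
    · exact ⟨t₀, h1, h2, .inr ⟨h0, .inl hc⟩⟩
  support := slowNetwork_support k B
  ker t z hz := by
    funext w
    have h : ∀ w', z w' = z w := fun w' => hz w' w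
    simp only [gossip, h, ← Finset.sum_smul]
    have : ∑ w', (slowNetwork k B).W t w w' = 0 := by
      simp only [slowNetwork, Matrix.sub_apply, Finset.sum_sub_distrib,
        sum_pairAverage_roundMatrix]
      simp [Matrix.one_apply]
    rw [this, zero_smul, Pi.zero_apply]
  range t z := by
    simp only [gossip]
    rw [Finset.sum_comm]
    refine Finset.sum_eq_zero fun w' _ => ?_
    rw [← Finset.sum_smul]
    have : ∑ w, (slowNetwork k B).W t w w' = 0 := by
      simp only [slowNetwork, Matrix.sub_apply, Finset.sum_sub_distrib,
        pairAverage_roundMatrix_comm k B t _ w', sum_pairAverage_roundMatrix]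
      simp [Matrix.one_apply]
    rw [this, zero_smul]
  one_le := by
    refine le_trans ?_ hχ
    exact_mod_cast (by omega : 1 ≤ k + 3)
  contract t z hz := by
    obtain ⟨t₀, h0, h1, h2⟩ := exists_dvd_window B t hB
    obtain ⟨T, rfl⟩ : ∃ T, B = T + 1 := ⟨B - 1, by omega⟩
    have hmix := slowNetwork_mixing (k := k) h0 h1 h2 T le_rfl
    rw [if_pos (by omega)] at hmix
    set c := starCenter k (t₀ / (T + 1))
    have hg : ∀ (x : Fin ((k + 3) * 2) → Vec d) w,
        gossip ((slowNetwork k (T + 1)).multiW (T + 1) t) x w =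
          x w - ∑ v, starMatrix c w.divNat v •
            ((2 : ℝ)⁻¹ • (x (finProdFinEquiv (v, 0)) + x (finProdFinEquiv (v, 1)))) := by
      intro x w
      simp only [gossip, TVNetwork.multiW, hmix, Matrix.sub_apply, sub_smul,
        Finset.sum_sub_distrib]
      congr 1
      · simp [Matrix.one_apply]
      · simp only [sum_pairs, pairAverage, Matrix.of_apply, divNat_finProdFinEquiv, ← smul_add,
          smul_smul, div_eq_mul_inv]
    obtain ⟨x, rfl⟩ := hz
    set z := gossip ((slowNetwork k (T + 1)).multiW (T + 1) t) x with hz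
    set y : Fin (k + 3) → Vec d := fun v =>
      (2 : ℝ)⁻¹ • (z (finProdFinEquiv (v, 0)) + z (finProdFinEquiv (v, 1))) with hy
    have hcol : ∀ v, ∑ v', starMatrix c v' v = 1 := by
      intro v
      simp only [starMatrix_comm c _ v, sum_starMatrix]
    -- The column sums of the averaging are one, so elements of the range have zero sum, and so do
    -- their pair means.
    have hy0 : ∑ v, y v = 0 := by
      simp only [hy, ← Finset.smul_sum]
      rw [← sum_pairs, hz]
      simp only [hg, Finset.sum_sub_distrib]
      rw [Finset.sum_comm]
      simp only [← Finset.sum_smul, sum_pairs, divNat_finProdFinEquiv, Finset.sum_add_distrib,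
        hcol]
      simp only [← two_smul ℝ (1 : ℝ), smul_smul]
      simp [Finset.sum_add_distrib]
    have hlhs : ∑ w, ‖gossip ((slowNetwork k (T + 1)).multiW (T + 1) t) z w - z w‖ ^ 2 =
        2 * ∑ v, ‖∑ v', starMatrix c v v' • y v'‖ ^ 2 := by
      simp only [hg z, sub_sub_cancel_left, norm_neg]
      rw [sum_pairs]
      simp only [divNat_finProdFinEquiv, ← two_mul, ← Finset.mul_sum]
      rfl
    have hm := sum_norm_sq_starMatrix_smul_le c y hy0
    -- Replacing both members of a pair by their mean does not increase the sum of squares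
    -- (parallelogram law).
    have hyz : 2 * ∑ v, ‖y v‖ ^ 2 ≤ ∑ w, ‖z w‖ ^ 2 := by
      rw [sum_pairs, Finset.mul_sum]
      refine Finset.sum_le_sum fun v _ => ?_
      rw [hy]
      simp only [norm_smul, mul_pow]
      have := parallelogram_law_with_norm ℝ (z (finProdFinEquiv (v, 0)))
        (z (finProdFinEquiv (v, 1)))
      norm_num
      nlinarith [sq_nonneg ‖z (finProdFinEquiv (v, 0)) - z (finProdFinEquiv (v, 1))‖]
    have hχ' : χ⁻¹ ≤ ((k + 3 : ℕ) : ℝ)⁻¹ := inv_anti₀ (by positivity) hχ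
    have hk1 : ((k + 3 : ℕ) : ℝ)⁻¹ ≤ 1 :=
      inv_le_one_of_one_le₀ (by exact_mod_cast (by omega : 1 ≤ k + 3))
    rw [hlhs]
    have hs : 0 ≤ ∑ w, ‖z w‖ ^ 2 := Finset.sum_nonneg fun _ _ => sq_nonneg _
    calc _ ≤ 2 * ((1 - ((k + 3 : ℕ) : ℝ)⁻¹) * ∑ v, ‖y v‖ ^ 2) := by linarith
      _ = (1 - ((k + 3 : ℕ) : ℝ)⁻¹) * (2 * ∑ v, ‖y v‖ ^ 2) := by ring
      _ ≤ (1 - ((k + 3 : ℕ) : ℝ)⁻¹) * ∑ w, ‖z w‖ ^ 2 := by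
          exact mul_le_mul_of_nonneg_left hyz (by linarith)
      _ ≤ _ := by gcongr

/-! ### Growth of the memories -/

section oracle

variable {M n d : ℕ} {μ a r : ℝ}

theorem hardVI_F_mem_succ (w : Fin M) (i : Fin n) {l : ℕ} (hl : 1 ≤ l) {z : Vec d}
    (hz : z ∈ leadingSubspace d l) : (hardVI M n d μ a r).F w i z ∈ leadingSubspace d (l + 1) := by
  have hz' := leadingSubspace_mono (Nat.le_succ l) hz
  exact sub_mem (add_mem (add_mem (Submodule.smul_mem _ _ hz')
    (Submodule.smul_mem _ _ (workerDamping_mem hz')))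
    (Submodule.smul_mem _ _ (workerSkew_mem_succ _ hz)))
    (Submodule.smul_mem _ _ (firstVec_mem (by omega)))

/-- The two ways of not progressing: a component without links, or a worker whose links do not cross
the current level. -/
theorem hardVI_F_mem (w : Fin M) (i : Fin n) {l : ℕ} (hl : 1 ≤ l)
    (h : (i : ℕ) ≠ 0 ∨ (((w : ℕ) = 0 → l % 2 = 0) ∧ ((w : ℕ) = 2 → l % 2 = 1))) {z : Vec d}
    (hz : z ∈ leadingSubspace d l) : (hardVI M n d μ a r).F w i z ∈ leadingSubspace d l := by
  refine sub_mem (add_mem (add_mem (Submodule.smul_mem _ _ hz)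
    (Submodule.smul_mem _ _ (workerDamping_mem hz))) ?_)
    (Submodule.smul_mem _ _ (firstVec_mem hl))
  rcases h with h | ⟨h0, h2⟩
  · rw [if_neg h, zero_mul, zero_smul]
    exact zero_mem _
  · exact Submodule.smul_mem _ _ (workerSkew_mem h0 h2 hz)

theorem oracleSpan_hardVI_le {w : Fin M} {S : Finset (Fin n)} {Mem : Set (Vec d)}
    {E : Submodule ℝ (Vec d)} (hMem : Mem ⊆ E)
    (hF : ∀ z ∈ Mem, ∑ i ∈ S, (hardVI M n d μ a r).F w i z ∈ E) :
    (hardVI M n d μ a r).oracleSpan w S Mem ≤ E := by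
  have h : Mem ∪ (fun z => ∑ i ∈ S, (hardVI M n d μ a r).F w i z) '' Mem ⊆ E := by
    refine Set.union_subset hMem ?_
    rintro _ ⟨z, hz, rfl⟩
    exact hF z hz
  refine Submodule.span_le.2 (Set.union_subset h ?_)
  rintro p ⟨ρ, -, v, hv, hp⟩
  rw [isProx_hardVI hp]
  exact Submodule.span_le.2 h hv

end oracle

namespace Procedure

variable {M n d : ℕ} {μ a r : ℝ} {N : TVNetwork M}
  {Ω : Type*} [mΩ : MeasurableSpace Ω] {ℙ : Measure Ω}

/-- The number of communication rounds before iteration `k`. -/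
noncomputable def roundsBefore {P : DecentralizedVI M n d} (A : Procedure P N ℙ) (k : ℕ) (ω : Ω) :
    ℕ := {j | j < k ∧ ω ∈ A.comm j}.ncard

theorem roundsBefore_succ_of_mem {P : DecentralizedVI M n d} (A : Procedure P N ℙ) {k : ℕ} {ω : Ω}
    (h : ω ∈ A.comm k) : A.roundsBefore (k + 1) ω = A.roundsBefore k ω + 1 := by
  have hf : {j | j < k ∧ ω ∈ A.comm j}.Finite := (Set.finite_lt_nat k).subset fun _ h => h.1
  rw [roundsBefore, roundsBefore, ← Set.ncard_insert_of_notMem (a := k) (by simp) hf]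
  congr 1
  ext j
  simp only [Set.mem_ofPred_eq, Set.mem_insert_iff, Nat.lt_succ_iff_lt_or_eq]
  grind

theorem roundsBefore_succ_of_notMem {P : DecentralizedVI M n d} (A : Procedure P N ℙ) {k : ℕ}
    {ω : Ω} (h : ω ∉ A.comm k) : A.roundsBefore (k + 1) ω = A.roundsBefore k ω := by
  rw [roundsBefore, roundsBefore]
  congr 1
  ext j
  simp only [Set.mem_ofPred_eq, Nat.lt_succ_iff_lt_or_eq]
  grind

/-- A bound for the levels of the memories that respects local iterations and communication
rounds bounds them throughout. -/
theorem mem_subset_leadingSubspace (A : Procedure (hardVI M n d μ a r) N ℙ) (ω : Ω)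
    (f : ℕ → Fin M → ℕ)
    (hlocal : ∀ k, ω ∉ A.comm k → ∀ w, f k w ≤ f (k + 1) w ∧
      ∀ z ∈ leadingSubspace d (f k w),
        ∑ i ∈ A.S k w ω, (hardVI M n d μ a r).F w i z ∈ leadingSubspace d (f (k + 1) w))
    (hcomm : ∀ k, ω ∈ A.comm k → ∀ w w', w' = w ∨ N.Edge (A.roundsBefore k ω) w' w →
      f k w' ≤ f (k + 1) w) (k : ℕ) (w : Fin M) :
    A.mem k w ω ⊆ leadingSubspace d (f k w) := by
  induction k generalizing w with
  | zero =>
    rw [A.mem_init]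
    simp
  | succ k ih =>
    by_cases h : ω ∈ A.comm k
    · rw [A.mem_comm k w ω h]
      refine Submodule.span_le.2 (Set.union_subset ?_ (Set.iUnion₂_subset fun w' hw' => ?_))
      · exact (ih w).trans (leadingSubspace_mono (hcomm k h w w (.inl rfl)))
      · exact (ih w').trans (leadingSubspace_mono (hcomm k h w w' (.inr hw')))
    · obtain ⟨X, -, hX, hm⟩ := A.mem_local k w ω h
      obtain ⟨h1, h2⟩ := hlocal k h w
      have h3 : A.mem k w ω ⊆ leadingSubspace d (f (k + 1) w) :=
        (ih w).trans (leadingSubspace_mono h1)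
      rw [hm]
      exact Set.union_subset h3 (hX.trans (oracleSpan_hardVI_le h3 fun z hz => h2 z (ih w hz)))

/-- The number of the workers with links that see the component `0` in iteration `k`. -/
noncomputable def hits {P : DecentralizedVI M n d} (A : Procedure P N ℙ) (w₀ w₁ : Fin M)
    (i₀ : Fin n) (k : ℕ) (ω : Ω) : ℕ :=
  (if i₀ ∈ A.S k w₀ ω then 1 else 0) + (if i₀ ∈ A.S k w₁ ω then 1 else 0)

/-- Communication is treated as free: one common level for all workers rises only when worker `0` or
`2` samples component `0`. -/
theorem out_mem_leadingSubspace_hits (A : Procedure (hardVI M n d μ a r) N ℙ) (ω : Ω)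
    {w₀ w₁ : Fin M} (hw₀ : (w₀ : ℕ) = 0) (hw₁ : (w₁ : ℕ) = 2) {i₀ : Fin n} (hi₀ : (i₀ : ℕ) = 0) :
    A.out ω ∈ leadingSubspace d (1 + ∑ k ∈ Finset.range A.steps, A.hits w₀ w₁ i₀ k ω) := by
  have key := A.mem_subset_leadingSubspace ω
    (fun k _ => 1 + ∑ j ∈ Finset.range k, A.hits w₀ w₁ i₀ j ω) ?_ ?_ A.steps
  · exact Submodule.span_le.2 (Set.iUnion_subset key) (A.out_mem ω)
  · intro k _ w
    simp only [Finset.sum_range_succ]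
    refine ⟨by omega, fun z hz => Submodule.sum_mem _ fun i hi => ?_⟩
    by_cases h : (i : ℕ) = 0 ∧ ((w : ℕ) = 0 ∨ (w : ℕ) = 2)
    · refine leadingSubspace_mono ?_ (hardVI_F_mem_succ w i (by omega) hz)
      obtain rfl : i = i₀ := by ext; omega
      have : 1 ≤ A.hits w₀ w₁ i k ω := by
        rcases h.2 with hw | hw
        · obtain rfl : w = w₀ := by ext; omega
          simp [hits, hi]
        · obtain rfl : w = w₁ := by ext; omega
          simp [hits, hi]
      omega
    · exact leadingSubspace_mono (by omega) (hardVI_F_mem w i (by omega) (by omega) hz)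
  · intro k _ w w' _
    simp only [Finset.sum_range_succ]
    omega

end Procedure

/-! ### Spread of levels over the rotating star -/

/-- The level of pair `v` after `s` active rounds of the network with `k + 3` pairs. -/
def pairLevel (k s v : ℕ) : ℕ :=
  if v = 0 then 2 * (s / (k + 1) / 2) + 2
  else if v = 1 then 2 * ((s / (k + 1) + 1) / 2) + 1
  else if v - 2 < s % (k + 1) then s / (k + 1) + 2 else s / (k + 1) + 1

theorem pairLevel_le (k s v : ℕ) : pairLevel k s v ≤ s / (k + 1) + 2 := by
  unfold pairLevel
  split_ifs <;> omega

theorem le_pairLevel (k s v : ℕ) : s / (k + 1) + 1 ≤ pairLevel k s v := by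
  unfold pairLevel
  split_ifs <;> omega

theorem succ_div_mod (k s : ℕ) :
    ((s + 1) / (k + 1) = s / (k + 1) ∧ (s + 1) % (k + 1) = s % (k + 1) + 1) ∨
      ((s + 1) / (k + 1) = s / (k + 1) + 1 ∧ s % (k + 1) = k) := by
  have h1 := Nat.div_add_mod s (k + 1)
  have h2 := Nat.mod_lt s (by omega : 0 < k + 1)
  rcases Nat.lt_or_ge (s % (k + 1) + 1) (k + 1) with h | h
  · left
    exact (Nat.div_mod_unique (by omega : 0 < k + 1)).2 ⟨by omega, h⟩
  · right
    refine ⟨?_, by omega⟩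
    refine Nat.div_eq_of_lt_le ?_ ?_ <;> nlinarith

/-- With `q = s / (k + 1)` completed cycles all levels are `q + 1` or `q + 2`. The present center
still has `q + 1`, so what it sends is harmless; it may itself rise to `q + 2`. Pairs `0` and `1`
have the largest even and odd number up to `q + 2`. -/
theorem pairLevel_succ_ge (k s : ℕ) {v v' : ℕ} (hv' : v' < k + 3)
    (h : v' = v ∨ v' = 2 + s % (k + 1) ∨ v = 2 + s % (k + 1)) :
    pairLevel k s v' ≤ pairLevel k (s + 1) v := by
  have h1 := Nat.mod_lt s (by omega : 0 < k + 1)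
  rcases succ_div_mod k s with ⟨h2, h3⟩ | ⟨h2, h3⟩
  · rcases h with rfl | rfl | rfl
    · unfold pairLevel
      rw [h2, h3]
      split_ifs <;> omega
    · refine le_trans (le_of_eq ?_) (le_pairLevel k (s + 1) v)
      unfold pairLevel
      rw [if_neg (by omega), if_neg (by omega), if_neg (by omega), h2]
    · refine (pairLevel_le k s v').trans (le_of_eq ?_)
      unfold pairLevel
      rw [if_neg (by omega), if_neg (by omega), if_pos (by omega), h2]
  -- At the end of a cycle the old upper bound `q + 2` is the new lower bound.
  · refine (pairLevel_le k s v').trans (le_trans (by omega) (le_pairLevel k (s + 1) v))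

/-- The number of active rounds among the first `t` rounds. -/
def activeRounds (B t : ℕ) : ℕ := (t + B - 1) / B

theorem activeRounds_succ_of_dvd {B t : ℕ} (hB : 1 ≤ B) (h : B ∣ t) :
    activeRounds B t = t / B ∧ activeRounds B (t + 1) = t / B + 1 := by
  obtain ⟨s, rfl⟩ := h
  rw [Nat.mul_div_cancel_left _ hB]
  unfold activeRounds
  refine ⟨?_, ?_⟩
  · refine Nat.div_eq_of_lt_le ?_ ?_ <;> grind
  · refine Nat.div_eq_of_lt_le ?_ ?_ <;> grind

theorem activeRounds_succ_of_not_dvd {B t : ℕ} (h : ¬ B ∣ t) :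
    activeRounds B (t + 1) = activeRounds B t := by
  unfold activeRounds
  rcases Nat.eq_zero_or_pos B with rfl | hB
  · simp
  obtain ⟨u, rfl⟩ : ∃ u, t = u + 1 := ⟨t - 1, by
    have : t ≠ 0 := by rintro rfl; simp at h
    omega⟩
  have e1 : u + 1 + 1 + B - 1 = (u + 1) + B := by omega
  have e2 : u + 1 + B - 1 = u + B := by omega
  rw [e1, e2, Nat.add_div_right _ hB, Nat.add_div_right _ hB, Nat.succ_div_of_not_dvd h]

namespace Procedure

variable {k B n d : ℕ} {μ a r : ℝ} {Ω : Type*} [mΩ : MeasurableSpace Ω] {ℙ : Measure Ω}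

/-- Here local work is free: the level of pair `0` is even and that of pair `1` odd, where the links
of workers `0` and `2` cannot raise it. Only active rounds count. -/
theorem out_mem_leadingSubspace_commRounds
    (A : Procedure (hardVI ((k + 3) * 2) n d μ a r) (slowNetwork k B) ℙ) (hB : 1 ≤ B) (ω : Ω) :
    A.out ω ∈ leadingSubspace d (activeRounds B (A.commRounds ω) / (k + 1) + 2) := by
  have key := A.mem_subset_leadingSubspace ω
    (fun j w => pairLevel k (activeRounds B (A.roundsBefore j ω)) (w.divNat : ℕ)) ?_ ?_ A.steps
  · refine Submodule.span_le.2 (Set.iUnion_subset fun w => (key w).trans ?_) (A.out_mem ω)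
    exact leadingSubspace_mono (pairLevel_le _ _ _)
  · intro j hj w
    rw [A.roundsBefore_succ_of_notMem hj]
    refine ⟨le_rfl, fun z hz => Submodule.sum_mem _ fun i hi => ?_⟩
    refine hardVI_F_mem w i ((Nat.le_add_left _ _).trans (le_pairLevel _ _ _))
      (.inr ⟨fun h => ?_, fun h => ?_⟩) hz
    · have : (w.divNat : ℕ) = 0 := by simp [h]
      rw [this]
      simp [pairLevel]
    · have : (w.divNat : ℕ) = 1 := by simp [h]
      rw [this]
      simp [pairLevel]
  · intro j hj w w' hw
    rw [A.roundsBefore_succ_of_mem hj]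
    generalize A.roundsBefore j ω = t at hw ⊢
    by_cases hd : B ∣ t
    · obtain ⟨h1, h2⟩ := activeRounds_succ_of_dvd hB hd
      rw [h1, h2]
      refine pairLevel_succ_ge k _ w'.divNat.2 ?_
      rcases hw with rfl | h | ⟨-, h | h⟩
      · exact .inl rfl
      · exact .inl (congrArg _ h)
      · exact .inr (.inl (congrArg Fin.val h))
      · exact .inr (.inr (congrArg Fin.val h))
    · rw [activeRounds_succ_of_not_dvd hd]
      rcases hw with rfl | h | ⟨h, -⟩
      · exact le_rfl
      · rw [h]
      · exact absurd h hd

end Procedure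

/-! ### Expected number of hits -/

/-- A fixed element lies in a fraction `c / n` of the subsets of size `c`; the complement is counted
by `(n - 1).choose c`. -/
theorem card_powersetCard_filter_mem {n : ℕ} (c : ℕ) (i₀ : Fin n) :
    (((Finset.powersetCard c Finset.univ).filter (i₀ ∈ ·)).card : ℝ) * n = c * n.choose c := by
  have h1 : (Finset.powersetCard c (Finset.univ : Finset (Fin n))).filter (i₀ ∉ ·) =
      Finset.powersetCard c (Finset.univ.erase i₀) := by
    ext s
    simp only [Finset.mem_filter, Finset.mem_powersetCard, Finset.subset_univ, true_and,
      Finset.subset_erase]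
    exact and_comm
  have h2 := Finset.card_filter_add_card_filter_not
    (s := Finset.powersetCard c (Finset.univ : Finset (Fin n))) (i₀ ∈ ·)
  rw [h1, Finset.card_powersetCard, Finset.card_powersetCard, Finset.card_erase_of_mem
    (Finset.mem_univ _), Finset.card_univ, Fintype.card_fin] at h2
  obtain ⟨n, rfl⟩ : ∃ m, n = m + 1 := ⟨n - 1, by have := i₀.pos; omega⟩
  rw [Nat.add_sub_cancel] at h2
  have h3 := Nat.choose_mul_succ_eq n c
  rcases Nat.lt_or_ge (n + 1) c with hc | hc
  · rw [Nat.choose_eq_zero_of_lt hc] at h2 ⊢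
    have : ((Finset.powersetCard c Finset.univ).filter (i₀ ∈ ·)).card = 0 := by omega
    rw [this]; simp
  · have h2' : (((Finset.powersetCard c Finset.univ).filter (i₀ ∈ ·)).card : ℝ) + n.choose c =
        (n + 1).choose c := by exact_mod_cast h2
    have h3' : (n.choose c : ℝ) * (n + 1 : ℕ) = (n + 1).choose c * ((n + 1 : ℕ) - c) := by
      rw [← Nat.cast_sub hc]; exact_mod_cast h3
    linear_combination ((n + 1 : ℕ) : ℝ) * h2' - h3'

namespace Procedure

variable {M n d : ℕ} {P : DecentralizedVI M n d} {N : TVNetwork M}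
  {Ω : Type*} [mΩ : MeasurableSpace Ω] {ℙ : Measure Ω}

theorem measurableSet_b (A : Procedure P N ℙ) (k : ℕ) (c : Fin M → ℕ) :
    MeasurableSet[A.info k] {ω | ∀ m, A.b k m ω = c m} := by
  have : {ω | ∀ m, A.b k m ω = c m} = ⋂ m, {ω | A.b k m ω = c m} := by ext; simp
  rw [this]
  exact MeasurableSet.iInter fun m => A.b_meas k m (c m)

theorem measurableSet_S (A : Procedure P N ℙ) (k : ℕ) (m : Fin M) (s : Finset (Fin n)) :
    MeasurableSet {ω | A.S k m ω = s} :=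
  A.info.le (k + 1) _ (A.S_meas k m s)

theorem measurableSet_mem_S (A : Procedure P N ℙ) (k : ℕ) (m : Fin M) (i : Fin n) :
    MeasurableSet {ω | i ∈ A.S k m ω} := by
  have : {ω | i ∈ A.S k m ω} = ⋃ s ∈ {s : Finset (Fin n) | i ∈ s}, {ω | A.S k m ω = s} := by
    ext; simp
  rw [this]
  exact MeasurableSet.biUnion (Set.to_countable _) fun s _ => A.measurableSet_S k m s

/-- Once all batch sizes are fixed, the joint law of the batches is a product. Summing it over the
batches with `i₀` at worker `w` leaves `c w / n` from `w` and `1` from every other worker. -/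
theorem measureReal_inter_mem_S [IsProbabilityMeasure ℙ] (A : Procedure P N ℙ) (k : ℕ) (w : Fin M)
    (i₀ : Fin n) (c : Fin M → ℕ) (hc : ∀ m, c m ≤ n) :
    n * ℙ.real ({ω | ∀ m, A.b k m ω = c m} ∩ {ω | i₀ ∈ A.S k w ω}) =
      ℙ.real {ω | ∀ m, A.b k m ω = c m} * c w := by
  set E := {ω | ∀ m, A.b k m ω = c m} with hE
  have hEm : MeasurableSet E := A.info.le k _ (A.measurableSet_b k c)
  let t : Fin M → Finset (Finset (Fin n)) := fun m =>
    (Finset.powersetCard (c m) Finset.univ).filter fun x => m = w → i₀ ∈ x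
  have hset : E ∩ {ω | i₀ ∈ A.S k w ω} =
      ⋃ s ∈ Fintype.piFinset t, E ∩ {ω | ∀ m, A.S k m ω = s m} := by
    ext ω
    simp only [Set.mem_inter_iff, Set.mem_iUnion, Set.mem_ofPred_eq, exists_prop, t,
      Fintype.mem_piFinset, Finset.mem_filter, Finset.mem_powersetCard, Finset.subset_univ,
      true_and]
    constructor
    · rintro ⟨h1, h2⟩
      exact ⟨fun m => A.S k m ω, fun m => ⟨(A.card_S k m ω).trans (h1 m), fun h => h ▸ h2⟩, h1,
        fun _ => rfl⟩
    · rintro ⟨s, hs, h1, h2⟩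
      exact ⟨h1, h2 w ▸ (hs w).2 rfl⟩
  have hmeas : ∀ s ∈ Fintype.piFinset t, MeasurableSet (E ∩ {ω | ∀ m, A.S k m ω = s m}) := by
    intro s _
    have : {ω | ∀ m, A.S k m ω = s m} = ⋂ m, {ω | A.S k m ω = s m} := by ext; simp
    rw [this]
    exact hEm.inter (MeasurableSet.iInter fun m => A.measurableSet_S k m (s m))
  have hdisj : Set.PairwiseDisjoint (Fintype.piFinset t : Set (Fin M → Finset (Fin n)))
      fun s => E ∩ {ω | ∀ m, A.S k m ω = s m} := by
    intro s _ s' _ hne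
    refine Set.disjoint_left.2 fun ω h h' => hne ?_
    funext m
    exact (h.2 m).symm.trans (h'.2 m)
  have hval : ∀ s ∈ Fintype.piFinset t, ℙ.real (E ∩ {ω | ∀ m, A.S k m ω = s m}) =
      ℙ.real E * ∏ m, ((n.choose (s m).card : ℕ) : ℝ)⁻¹ := by
    intro s hs
    have hcard : ∀ m, (s m).card = c m := by
      intro m
      have := Fintype.mem_piFinset.1 hs m
      simp only [t, Finset.mem_filter, Finset.mem_powersetCard] at this
      exact this.1.2
    rw [measureReal_def, A.uniform k E (A.measurableSet_b k c) s
      fun ω hω m => (hω m).trans (hcard m).symm]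
    simp [measureReal_def, ENNReal.toReal_mul, ENNReal.toReal_prod]
  rw [hset, measureReal_biUnion_finset hdisj hmeas, Finset.sum_congr rfl hval, ← Finset.mul_sum,
    ← Finset.prod_univ_sum t fun _ x => ((n.choose x.card : ℕ) : ℝ)⁻¹]
  have hfac : ∀ m, ∑ x ∈ t m, ((n.choose x.card : ℕ) : ℝ)⁻¹ =
      if m = w then (c w : ℝ) / n else 1 := by
    intro m
    have h0 : ((n.choose (c m) : ℕ) : ℝ) ≠ 0 := by
      exact_mod_cast (Nat.choose_pos (hc m)).ne'
    have h1 : ∑ x ∈ t m, ((n.choose x.card : ℕ) : ℝ)⁻¹ =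
        (t m).card * ((n.choose (c m) : ℕ) : ℝ)⁻¹ := by
      rw [← nsmul_eq_mul, ← Finset.sum_const]
      refine Finset.sum_congr rfl fun x hx => ?_
      simp only [t, Finset.mem_filter, Finset.mem_powersetCard] at hx
      rw [hx.1.2]
    rw [h1]
    split_ifs with hm
    · subst hm
      have hn : (n : ℝ) ≠ 0 := by have := i₀.pos; positivity
      have := card_powersetCard_filter_mem (c m) i₀
      simp only [t, true_imp_iff]
      field_simp
      linarith
    · simp [t, hm, h0]
  have hn : (n : ℝ) ≠ 0 := by have := i₀.pos; positivity
  simp only [hfac, Finset.prod_ite_eq', Finset.mem_univ, if_true]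
  field_simp

theorem b_le (A : Procedure P N ℙ) (k : ℕ) (m : Fin M) (ω : Ω) : A.b k m ω ≤ n := by
  rw [← A.card_S]
  exact (Finset.card_le_univ _).trans_eq (Fintype.card_fin n)

theorem integrable_b [IsProbabilityMeasure ℙ] (A : Procedure P N ℙ) (k : ℕ) (m : Fin M) :
    Integrable (fun ω => (A.b k m ω : ℝ)) ℙ := by
  have hm : Measurable (A.b k m) := measurable_to_countable' fun j =>
    A.info.le k _ (A.b_meas k m j)
  refine Integrable.of_bound (C := n) (measurable_from_top.comp hm).aestronglyMeasurable
    (.of_forall fun ω => ?_)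
  simpa using A.b_le k m ω

/-- A fixed component is sampled with probability `E b / n`. -/
theorem measureReal_mem_S [IsProbabilityMeasure ℙ] (A : Procedure P N ℙ) (k : ℕ) (w : Fin M)
    (i₀ : Fin n) : n * ℙ.real {ω | i₀ ∈ A.S k w ω} = ∫ ω, (A.b k w ω : ℝ) ∂ℙ := by
  let C : Finset (Fin M → ℕ) := Fintype.piFinset fun _ => Finset.range (n + 1)
  let E : (Fin M → ℕ) → Set Ω := fun c => {ω | ∀ m, A.b k m ω = c m}
  have hEm : ∀ c, MeasurableSet (E c) := fun c => A.info.le k _ (A.measurableSet_b k c)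
  have hcov : ∀ ω, (fun m => A.b k m ω) ∈ C := fun ω =>
    Fintype.mem_piFinset.2 fun m => Finset.mem_range.2 (Nat.lt_succ_of_le (A.b_le k m ω))
  have hb : ∀ ω, (A.b k w ω : ℝ) = ∑ c ∈ C, (E c).indicator (fun _ => (c w : ℝ)) ω := by
    intro ω
    rw [Finset.sum_eq_single_of_mem _ (hcov ω)]
    · rw [Set.indicator_of_mem]
      exact fun _ => rfl
    · intro c _ hne
      rw [Set.indicator_of_notMem]
      exact fun h => hne (funext fun m => (h m).symm)
  have hset : {ω | i₀ ∈ A.S k w ω} = ⋃ c ∈ C, E c ∩ {ω | i₀ ∈ A.S k w ω} := by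
    ext ω
    simp only [Set.mem_iUnion, Set.mem_inter_iff, exists_prop]
    exact ⟨fun h => ⟨_, hcov ω, fun _ => rfl, h⟩, fun ⟨_, _, _, h⟩ => h⟩
  have hdisj : Set.PairwiseDisjoint (C : Set (Fin M → ℕ))
      fun c => E c ∩ {ω | i₀ ∈ A.S k w ω} := by
    intro c _ c' _ hne
    refine Set.disjoint_left.2 fun ω h h' => hne (funext fun m => ?_)
    exact (h.1 m).symm.trans (h'.1 m)
  rw [hset, measureReal_biUnion_finset hdisj
    fun c _ => (hEm c).inter (A.measurableSet_mem_S k w i₀), Finset.mul_sum]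
  simp only [hb]
  rw [integral_finsetSum _ fun c _ => (integrable_const _).indicator (hEm c)]
  refine Finset.sum_congr rfl fun c hc => ?_
  rw [integral_indicator_const _ (hEm c), smul_eq_mul]
  exact A.measureReal_inter_mem_S k w i₀ c fun m =>
    Nat.lt_succ_iff.1 (Finset.mem_range.1 (Fintype.mem_piFinset.1 hc m))

theorem hits_eq_indicator (A : Procedure P N ℙ) (w₀ w₁ : Fin M) (i₀ : Fin n) (k : ℕ) (ω : Ω) :
    (A.hits w₀ w₁ i₀ k ω : ℝ) = {ω | i₀ ∈ A.S k w₀ ω}.indicator (fun _ => (1 : ℝ)) ω +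
      {ω | i₀ ∈ A.S k w₁ ω}.indicator (fun _ => (1 : ℝ)) ω := by
  simp [hits, Set.indicator_apply]

theorem integrable_hits [IsProbabilityMeasure ℙ] (A : Procedure P N ℙ) (w₀ w₁ : Fin M)
    (i₀ : Fin n) (k : ℕ) : Integrable (fun ω => (A.hits w₀ w₁ i₀ k ω : ℝ)) ℙ := by
  simp only [hits_eq_indicator]
  exact ((integrable_const _).indicator (A.measurableSet_mem_S k w₀ i₀)).add
    ((integrable_const _).indicator (A.measurableSet_mem_S k w₁ i₀))

theorem integral_hits [IsProbabilityMeasure ℙ] (A : Procedure P N ℙ) (w₀ w₁ : Fin M)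
    (i₀ : Fin n) (k : ℕ) : n * ∫ ω, (A.hits w₀ w₁ i₀ k ω : ℝ) ∂ℙ =
      ∫ ω, (A.b k w₀ ω : ℝ) ∂ℙ + ∫ ω, (A.b k w₁ ω : ℝ) ∂ℙ := by
  simp only [hits_eq_indicator]
  rw [integral_add ((integrable_const _).indicator (A.measurableSet_mem_S k w₀ i₀))
    ((integrable_const _).indicator (A.measurableSet_mem_S k w₁ i₀)),
    integral_indicator_const _ (A.measurableSet_mem_S k w₀ i₀),
    integral_indicator_const _ (A.measurableSet_mem_S k w₁ i₀), smul_eq_mul, smul_eq_mul,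
    mul_one, mul_one, mul_add, A.measureReal_mem_S, A.measureReal_mem_S]

theorem integral_sum_hits_le [IsProbabilityMeasure ℙ] (A : Procedure P N ℙ) (w₀ w₁ : Fin M)
    (i₀ : Fin n) {K : ℕ} (hK : ∀ᵐ ω ∂ℙ, ∀ m, A.localComputations m ω ≤ K) :
    ∫ ω, (1 + ∑ k ∈ Finset.range A.steps, (A.hits w₀ w₁ i₀ k ω : ℝ)) ∂ℙ ≤ 1 + 2 * K / n := by
  have hn : (0 : ℝ) < n := by exact_mod_cast i₀.pos
  have hI := integrable_finsetSum (Finset.range A.steps)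
    fun k _ => A.integrable_hits w₀ w₁ i₀ k
  rw [integral_add (integrable_const _) hI, integral_finsetSum _
    fun k _ => A.integrable_hits w₀ w₁ i₀ k]
  have hb : ∀ m, ∑ k ∈ Finset.range A.steps, ∫ ω, (A.b k m ω : ℝ) ∂ℙ ≤ K := by
    intro m
    rw [← integral_finsetSum _ fun k _ => A.integrable_b k m]
    have : (K : ℝ) = ∫ _ω, (K : ℝ) ∂ℙ := by simp
    rw [this]
    refine integral_mono_ae (integrable_finsetSum _ fun k _ => A.integrable_b k m)
      (integrable_const _) ?_
    filter_upwards [hK] with ω hω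
    have := hω m
    rw [localComputations] at this
    exact_mod_cast this
  have h : n * ∑ k ∈ Finset.range A.steps, ∫ ω, (A.hits w₀ w₁ i₀ k ω : ℝ) ∂ℙ ≤ 2 * K := by
    rw [Finset.mul_sum]
    simp only [integral_hits, Finset.sum_add_distrib]
    linarith [hb w₀, hb w₁]
  have h' := (le_div_iff₀' hn).2 h
  simpa using h'

end Procedure

/-! ### Accuracy and levels -/

/-- Jensen's inequality for `l ↦ r^(2l)`, in the form of the tangent line at `Λ`. Since `log r < 0`,
a mean level below `Λ` only helps. -/
theorem exp_level_le_of_expectedSqError_le {M n d : ℕ} {P : DecentralizedVI M n d}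
    {N : TVNetwork M} {Ω : Type*} [MeasurableSpace Ω] {ℙ : Measure Ω} [IsProbabilityMeasure ℙ]
    (A : Procedure P N ℙ) {r ε Λ : ℝ} (hr0 : 0 < r) (hr1 : r < 1) (hε : 0 ≤ ε)
    (hA : A.expectedSqError (geomVec d r) ≤ ENNReal.ofReal ε) (l : Ω → ℕ)
    (hl : Integrable (fun ω => (l ω : ℝ)) ℙ) (hlΛ : ∫ ω, (l ω : ℝ) ∂ℙ ≤ Λ)
    (hout : ∀ᵐ ω ∂ℙ, A.out ω ∈ leadingSubspace d (l ω)) :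
    ‖geomVec d r‖ ^ 2 * (Real.exp (Λ * (2 * Real.log r)) - (r ^ 2) ^ d) ≤ ε := by
  set R := ‖geomVec d r‖ ^ 2 with hR
  have hR0 : 0 ≤ R := sq_nonneg _
  set t := 2 * Real.log r with ht
  have ht0 : t < 0 := by have := Real.log_neg hr0 hr1; linarith
  have hm : AEStronglyMeasurable (fun ω => ‖A.out ω - geomVec d r‖ ^ 2) ℙ :=
    ((A.out_meas.sub_const _).norm.pow_const 2).aestronglyMeasurable
  have h0 : 0 ≤ᵐ[ℙ] fun ω => ‖A.out ω - geomVec d r‖ ^ 2 := .of_forall fun _ => sq_nonneg _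
  have hint : Integrable (fun ω => ‖A.out ω - geomVec d r‖ ^ 2) ℙ := by
    refine ⟨hm, ?_⟩
    rw [hasFiniteIntegral_iff_ofReal h0]
    exact hA.trans_lt ENNReal.ofReal_lt_top
  have hle : ∫ ω, ‖A.out ω - geomVec d r‖ ^ 2 ∂ℙ ≤ ε := by
    rw [← ENNReal.ofReal_le_ofReal_iff hε, ofReal_integral_eq_lintegral_ofReal hint h0]
    exact hA
  set q := Real.exp (Λ * t) with hq
  have hq0 : 0 < q := Real.exp_pos _
  have hlow : Integrable (fun ω => R * (q * (1 + ((l ω : ℝ) - Λ) * t) - (r ^ 2) ^ d)) ℙ := by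
    fun_prop
  have hmono : ∫ ω, R * (q * (1 + ((l ω : ℝ) - Λ) * t) - (r ^ 2) ^ d) ∂ℙ ≤
      ∫ ω, ‖A.out ω - geomVec d r‖ ^ 2 ∂ℙ := by
    refine integral_mono_ae hlow hint ?_
    filter_upwards [hout] with ω hω
    refine le_trans ?_ (norm_sq_sub_geomVec_ge hr0 hr1 hω)
    refine mul_le_mul_of_nonneg_left (sub_le_sub_right ?_ _) hR0
    have e1 : (r ^ 2) ^ l ω = q * Real.exp (((l ω : ℝ) - Λ) * t) := by
      rw [hq, ← Real.exp_add, ht, ← Real.exp_log (pow_pos (pow_pos hr0 2) (l ω)), Real.log_pow,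
        Real.log_pow]
      congr 1
      push_cast
      ring
    rw [e1]
    have := Real.add_one_le_exp (((l ω : ℝ) - Λ) * t)
    exact mul_le_mul_of_nonneg_left (by linarith) hq0.le
  have hval : ∫ ω, R * (q * (1 + ((l ω : ℝ) - Λ) * t) - (r ^ 2) ^ d) ∂ℙ =
      R * (q * (1 + (∫ ω, (l ω : ℝ) ∂ℙ - Λ) * t) - (r ^ 2) ^ d) := by
    rw [integral_const_mul, integral_sub (by fun_prop) (by fun_prop), integral_const_mul,
      integral_add (by fun_prop) (by fun_prop), integral_mul_const,
      integral_sub hl (by fun_prop)]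
    simp
  refine le_trans ?_ (hval.symm.le.trans (hmono.trans hle))
  refine mul_le_mul_of_nonneg_left (sub_le_sub_right ?_ _) hR0
  have : 0 ≤ (∫ ω, (l ω : ℝ) ∂ℙ - Λ) * t := mul_nonneg_of_nonpos_of_nonpos (by linarith) ht0.le
  nlinarith

/-- The truncation error `D * R` is at most `ε`, so `r^(2Λ) ≤ 2 ε / R`; the factor `2` costs `log
2`, which is absorbed in half of `log (R / ε)`. -/
theorem level_ge_of_exp_level_le {a μ r R ε δ Λ D : ℝ} (ha : 0 < a) (hμ : 0 < μ)
    (hr : -Real.log r ≤ μ / a) (hR : 0 < R) (hδ : 0 < δ) (hD : D ≤ δ) (hΛ : 0 ≤ Λ)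
    (h1 : δ * R ≤ ε) (h2 : ε ≤ Real.exp (-96) * R)
    (h : R * (Real.exp (Λ * (2 * Real.log r)) - D) ≤ ε) :
    96 ≤ Real.log (R / ε) ∧ a / (4 * μ) * Real.log (R / ε) ≤ Λ := by
  have hε : 0 < ε := (mul_pos hδ hR).trans_le h1
  have hlog : 96 ≤ Real.log (R / ε) := by
    rw [Real.le_log_iff_exp_le (by positivity), le_div_iff₀ hε]
    calc Real.exp 96 * ε ≤ Real.exp 96 * (Real.exp (-96) * R) := by gcongr
      _ = R := by rw [← mul_assoc, ← Real.exp_add]; simp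
  refine ⟨hlog, ?_⟩
  have h3 : Real.exp (Λ * (2 * Real.log r)) ≤ 2 * (ε / R) := by
    have e : D * R ≤ ε := (mul_le_mul_of_nonneg_right hD hR.le).trans h1
    rw [← mul_div_assoc, le_div_iff₀ hR]
    linarith
  have h4 := (Real.le_log_iff_exp_le (by positivity)).2 h3
  rw [Real.log_mul (by norm_num) (by positivity), ← inv_div R ε, Real.log_inv] at h4
  have h5 : Real.log 2 ≤ 1 := by linarith [Real.log_two_lt_d9]
  have h6 : Λ * (-Real.log r) ≤ Λ * (μ / a) := mul_le_mul_of_nonneg_left hr hΛ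
  have h7 : Real.log (R / ε) ≤ 4 * (Λ * (μ / a)) := by linarith
  calc a / (4 * μ) * Real.log (R / ε) ≤ a / (4 * μ) * (4 * (Λ * (μ / a))) := by gcongr
    _ = Λ := by field_simp

theorem activeRounds_le {B t : ℕ} (hB : 1 ≤ B) : (activeRounds B t : ℝ) ≤ t / B + 1 := by
  have hB' : (0 : ℝ) < B := by exact_mod_cast hB
  refine (Nat.cast_div_le).trans ?_
  rw [div_le_iff₀ hB', add_mul, div_mul_cancel₀ _ hB'.ne', one_mul]
  exact_mod_cast (by omega : t + B - 1 ≤ t + B)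

theorem activeRounds_mono {B s t : ℕ} (h : s ≤ t) : activeRounds B s ≤ activeRounds B t :=
  Nat.div_le_div_right (by omega)

/-- Communication and local computation lower bounds over time-varying networks. The constants
`c` and `ε₀` are absolute. The starting point is `0`, so that `R₀² = ‖0 - zstar‖²`. The hard
problem (its dimension, for instance) depends on the smallest relative accuracy `δ` under
consideration, and it is hard for all accuracies `ε` between `δ R₀²` and `ε₀ R₀²` at once. -/
theorem corollary2 :
    ∃ c ε₀ : ℝ, 0 < c ∧ 0 < ε₀ ∧
      ∀ (Lbar μ χ : ℝ) (n B : ℕ), 0 < μ → 1 ≤ n → 1 ≤ B → 3 ≤ χ → √n * μ ≤ Lbar →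
      ∀ δ : ℝ, 0 < δ →
      ∃ (M d : ℕ) (P : DecentralizedVI M n d) (N : TVNetwork M) (zstar : Vec d),
        P.RegularizerOK ∧
        P.IsLipschitz (Lbar / √n) ∧
        P.IsAverageLipschitz Lbar ∧
        IsStronglyMonotone μ P.globalOp ∧
        (∀ m, IsStronglyMonotone (μ / M) (P.localOp m)) ∧
        N.IsAdmissible d B χ ∧
        P.IsSolution zstar ∧
        zstar ≠ 0 ∧
        ∀ ε : ℝ, δ * ‖0 - zstar‖ ^ 2 ≤ ε → ε ≤ ε₀ * ‖0 - zstar‖ ^ 2 →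
        ∀ (Ω : Type*) [MeasurableSpace Ω] (ℙ : Measure Ω) [IsProbabilityMeasure ℙ]
          (A : Procedure P N ℙ) (Kcomm Nloc : ℕ),
          (∀ᵐ ω ∂ℙ, A.commRounds ω ≤ Kcomm) →
          (∀ᵐ ω ∂ℙ, ∀ m, A.localComputations m ω ≤ Nloc) →
          A.expectedSqError zstar ≤ ENNReal.ofReal ε →
            c * (B * χ * (1 + (Lbar / √n) / μ) * Real.log (‖0 - zstar‖ ^ 2 / ε)) ≤ Kcomm ∧
            c * ((n + √n * (Lbar / μ)) * Real.log (‖0 - zstar‖ ^ 2 / ε)) ≤ Nloc := by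
  -- `96 = 3 * 32` lets half of `(L / μ) H / 16` absorb an additive loss of up to `3` levels. `256 =
  -- 32 * 4 * 2` collects the remaining `1/32`, `χ ≤ 4 (k + 1)` and `1 + L / μ ≤ 2 L / μ`.
  refine ⟨1 / 256, Real.exp (-96), by norm_num, Real.exp_pos _, ?_⟩
  intro Lbar μ χ n B hμ hn hB hχ hLbar δ hδ
  have hn' : (0 : ℝ) < n := by exact_mod_cast hn
  have hB' : (0 : ℝ) < B := by exact_mod_cast hB
  have hsn : 0 < √(n : ℝ) := Real.sqrt_pos.2 hn'
  set L := Lbar / √(n : ℝ) with hL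
  have hLb : Lbar = √(n : ℝ) * L := by rw [hL]; field_simp
  have hμL : μ ≤ L := by rw [hL, le_div_iff₀ hsn]; linarith
  have hL0 : 0 < L := hμ.trans_le hμL
  -- The choice `k + 3 = ⌊χ⌋`, possible because `χ ≥ 3`.
  obtain ⟨k, hk1, hk2⟩ : ∃ k : ℕ, ((k + 3 : ℕ) : ℝ) ≤ χ ∧ χ ≤ 4 * ((k : ℝ) + 1) := by
    have h3 : 3 ≤ ⌊χ⌋₊ := Nat.le_floor (by exact_mod_cast hχ)
    have e : ⌊χ⌋₊ - 3 + 3 = ⌊χ⌋₊ := Nat.sub_add_cancel h3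
    refine ⟨⌊χ⌋₊ - 3, ?_, ?_⟩
    · rw [e]; exact Nat.floor_le (by linarith)
    · have h1 := Nat.lt_floor_add_one χ
      have h2 : ((⌊χ⌋₊ - 3 : ℕ) : ℝ) + 3 = (⌊χ⌋₊ : ℝ) := by exact_mod_cast e
      have h4 : (0 : ℝ) ≤ ((⌊χ⌋₊ - 3 : ℕ) : ℝ) := Nat.cast_nonneg _
      linarith
  have ha : 0 < L / 4 := by positivity
  obtain ⟨r, hr0, hr1, hr, hrlog⟩ := exists_root ha hμ
  -- The dimension makes the truncation term `r^(2d)` invisible at accuracy `δ`; this is the only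
  -- use of `δ` in the construction.
  obtain ⟨d, hd1, hd⟩ : ∃ d : ℕ, 1 ≤ d ∧ (r ^ 2) ^ d ≤ δ := by
    have hr2 : r ^ 2 < 1 := by nlinarith
    obtain ⟨d, hd⟩ := exists_pow_lt_of_lt_one hδ hr2
    exact ⟨d + 1, by omega,
      (pow_le_pow_of_le_one (by positivity) hr2.le (Nat.le_succ d)).trans hd.le⟩
  have hM : 6 ≤ (k + 3) * 2 := by omega
  have hz0 := geomVec_ne_zero hd1 hr0
  refine ⟨(k + 3) * 2, d, hardVI ((k + 3) * 2) n d μ (L / 4) r, slowNetwork k B, geomVec d r,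
    hardVI_regularizerOK, hardVI_isLipschitz hn hM hμ hμL rfl hr0.le hr1.le,
    hardVI_isAverageLipschitz hn hM hμ hμL rfl hr0.le hr1.le ?_,
    hardVI_globalOp_isStronglyMonotone hn (by omega) ha.le hr0.le,
    hardVI_localOp_isStronglyMonotone hn ha.le hr0.le,
    slowNetwork_isAdmissible k d B hB hk1, hardVI_isSolution hn hM hr, hz0, ?_⟩
  · rw [hLb, mul_pow, Real.sq_sqrt hn'.le]
  rw [zero_sub, norm_neg]
  intro ε hε1 hε2 Ω _ ℙ _ A Kcomm Nloc hK hN hA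
  have hR : 0 < ‖geomVec d r‖ ^ 2 := by positivity
  have hε : 0 ≤ ε := (mul_pos hδ hR).le.trans hε1
  set H := Real.log (‖geomVec d r‖ ^ 2 / ε) with hH
  have hLμ : 1 ≤ L / μ := (one_le_div hμ).2 hμL
  have hX : ∀ Λ : ℝ, L / 4 / (4 * μ) * H ≤ Λ ↔ L / μ * H / 16 ≤ Λ := by
    intro Λ
    rw [show L / 4 / (4 * μ) * H = L / μ * H / 16 by field_simp; ring]
  constructor
  · have hexp := exp_level_le_of_expectedSqError_le A hr0 hr1 hε hA
      (fun _ => activeRounds B Kcomm / (k + 1) + 2) (integrable_const _) (by simp; exact le_rfl)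
      (by
        filter_upwards [hK] with ω hω
        refine leadingSubspace_mono ?_ (A.out_mem_leadingSubspace_commRounds hB ω)
        have := Nat.div_le_div_right (c := k + 1) (activeRounds_mono (B := B) hω)
        omega)
    obtain ⟨hH96, hΛ⟩ := level_ge_of_exp_level_le ha hμ hrlog hR hδ hd (by positivity) hε1 hε2 hexp
    rw [hX] at hΛ
    have hk0 : (0 : ℝ) < (k : ℝ) + 1 := by positivity
    have h1 : ((activeRounds B Kcomm / (k + 1) : ℕ) : ℝ) ≤ Kcomm / (B * ((k : ℝ) + 1)) + 1 := by
      refine Nat.cast_div_le.trans ?_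
      push_cast
      rw [div_le_iff₀ hk0, add_mul, one_mul, ← div_div, div_mul_cancel₀ _ hk0.ne']
      have := activeRounds_le (t := Kcomm) hB
      have : (0 : ℝ) ≤ k := Nat.cast_nonneg k
      linarith
    -- The loss is `3`: `2` from the level bound and `1` from rounding the number of active rounds
    -- up.
    have hLH : H ≤ L / μ * H := le_mul_of_one_le_left (by linarith) hLμ
    have h2 : L / μ * H / 32 ≤ Kcomm / (B * ((k : ℝ) + 1)) := by
      linarith
    rw [le_div_iff₀ (by positivity)] at h2
    calc 1 / 256 * (B * χ * (1 + L / μ) * H)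
        ≤ 1 / 256 * (B * (4 * ((k : ℝ) + 1)) * (L / μ + L / μ) * H) := by gcongr
      _ = L / μ * H / 32 * (B * ((k : ℝ) + 1)) := by ring
      _ ≤ Kcomm := h2
  · have hM0 : 0 < (k + 3) * 2 := by omega
    have hM2 : 2 < (k + 3) * 2 := by omega
    have hl : ∀ ω, ((1 + ∑ j ∈ Finset.range A.steps,
        A.hits ⟨0, hM0⟩ ⟨2, hM2⟩ ⟨0, hn⟩ j ω : ℕ) : ℝ) = 1 + ∑ j ∈ Finset.range A.steps,
          (A.hits ⟨0, hM0⟩ ⟨2, hM2⟩ ⟨0, hn⟩ j ω : ℝ) := fun ω => by push_cast; rfl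
    have hexp := exp_level_le_of_expectedSqError_le A hr0 hr1 hε hA
      (fun ω => 1 + ∑ j ∈ Finset.range A.steps, A.hits ⟨0, hM0⟩ ⟨2, hM2⟩ ⟨0, hn⟩ j ω)
      (by
        simp only [hl]
        exact (integrable_const _).add
          (integrable_finsetSum _ fun j _ => A.integrable_hits _ _ _ j))
      (by
        simp only [hl]
        exact A.integral_sum_hits_le _ _ _ hN)
      (.of_forall fun ω => A.out_mem_leadingSubspace_hits ω rfl rfl rfl)
    obtain ⟨hH96, hΛ⟩ := level_ge_of_exp_level_le ha hμ hrlog hR hδ hd (by positivity) hε1 hε2 hexp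
    rw [hX] at hΛ
    have hLH : H ≤ L / μ * H := le_mul_of_one_le_left (by linarith) hLμ
    -- Here the loss is the initial level `1`.
    have h2 : L / μ * H / 32 ≤ 2 * Nloc / n := by linarith
    rw [le_div_iff₀ hn'] at h2
    have e : √(n : ℝ) * (Lbar / μ) = n * (L / μ) := by
      rw [hLb, ← mul_div_assoc, ← mul_assoc, Real.mul_self_sqrt hn'.le, mul_div_assoc]
    rw [e]
    have h3 : (n : ℝ) * H ≤ n * (L / μ * H) := by gcongr
    have h4 : (0 : ℝ) ≤ n * (L / μ * H) := by positivity
    linarith
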